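/- Let $Q$ and $Y$ be smooth manifolds and $\pi\colon Y\to Q$ a surjective submersion, with fibre products $Y^{[2]}=Y\times_Q Y$ and $Y^{[3]}=Y\times_Q Y\times_Q Y$. Let $(L,Y)$ be a bundle gerbe with connection and curving over $Q$: a hermitian line bundle $L\to Y^{[2]}$ with connection $\nabla$, an associative product $L_{(y_1,y_2)}\otimes L_{(y_2,y_3)}\cong L_{(y_1,y_3)}$ that is a smooth hermitian isomorphism over $Y^{[3]}$ and preserves the connections, and a complex-valued 2-form $f$ on $Y$ such that the curvature of $\nabla$ at $(y_1,y_2)$ is $f_{y_1}-f_{y_2}$. Let $E$ be a bundle gerbe module of finite rank $r$ with bundle gerbe module connection $A$: a hermitian vector bundle $E\to Y$ of rank $r$ with connection $A$ and a smooth hermitian isomorphism $L_{(y_1,y_2)}\otimes E_{y_2}\cong E_{y_1}$ over $Y^{[2]}$, compatible with the product of $L$ and preserving the connections. Let $D\subset\mathbb C$ be the closed unit disk, oriented as usual, and let $D(Q)$ be the set of smooth maps $\sigma\colon D\to Q$. For $\sigma\in D(Q)$ let $\sigma^*Y=D\times_Q Y$, with projection to $D$ again denoted by $\pi$. A trivialisation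 with compatible connection over $\sigma$ is a hermitian line bundle $J\to\sigma^*Y$ with a connection $\nabla_J$ and a smooth hermitian isomorphism $J_{(x,y_1)}\otimes J_{(x,y_2)}^*\cong L_{(y_1,y_2)}$ over the fibre square of $\sigma^*Y$ over $D$ that respects the products and the connections. Given such a $(J,\nabla_J)$ with curvature $F_J$, let $\mu_J$ be the 2-form on $D$ with $f-F_J=\pi^*\mu_J$ on $\sigma^*Y$, and let $(E_J,D_J)$ be the hermitian bundle with connection on $D$ to which $E\otimes J^*$, with the connection induced by $A$ and $\nabla_J$, descends (via $E_{y_1}\cong L_{(y_1,y_2)}\otimes E_{y_2}\cong J_{(x,y_1)}\otimes J_{(x,y_2)}^*\otimes E_{y_2}$). Let $\mathrm{hol}(D_J)$ be the holonomy (parallel transport) of $D_J$ once around the positively oriented boundary circle of $D$. Then the number $$s_A(\sigma)=\mathrm{tr}\,\mathrm{hol}(D_J)\cdot\exp\Big(\int_D\mu_J\Big)$$ does not depend on the choice of $(J,\nabla_J)$: there is a function $s_A\colon D(Q)\to\mathbb C$ such that for every $\sigma\in D(Q)$, every trivialisation with compatible connection $(J,\nabla_J)$ over $\sigma$, and every $\mu_J$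 and $(E_J,D_J)$ as above, this equality holds. -/

import Mathlib

open scoped Manifold ContDiff TensorProduct

noncomputable section

namespace BundleGerbes

universe u v u₁ v₁ u₂ v₂ u₃ v₃

/-! ### Differential forms along subsets of a manifold -/

section Forms

variable {F : Type*} [NormedAddCommGroup F] [NormedSpace ℝ F] {H : Type*} [TopologicalSpace H]

/-- The velocity of a curve. -/
def velocity (I : ModelWithCorners ℝ F H) {M : Type*} [TopologicalSpace M] [ChartedSpace H M]
    (c : ℝ → M) (t : ℝ) : TangentSpace I (c t) :=
  mfderiv 𝓘(ℝ, ℝ) I c t (1 : ℝ)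

/-- Complex-valued 1-forms (not necessarily smooth) on `M`. -/
abbrev OneForm (I : ModelWithCorners ℝ F H) (M : Type*) [TopologicalSpace M]
    [ChartedSpace H M] :=
  ∀ p : M, TangentSpace I p →L[ℝ] ℂ

/-- Complex-valued bilinear forms on the tangent spaces of `M`; see `IsSmoothTwoForm`. -/
abbrev TwoTensor (I : ModelWithCorners ℝ F H) (M : Type*) [TopologicalSpace M]
    [ChartedSpace H M] :=
  ∀ p : M, TangentSpace I p →L[ℝ] TangentSpace I p →L[ℝ] ℂ

variable (I : ModelWithCorners ℝ F H) {M : Type*} [TopologicalSpace M] [ChartedSpace H M]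
  [IsManifold I ∞ M]

/-- Smoothness of a 1-form along the subset `S`: it is a smooth section, over `S`, of the bundle
of continuous linear maps from the tangent bundle to `ℂ`. -/
def IsSmoothOneForm (S : Set M) (A : OneForm I M) : Prop :=
  ContMDiffOn I (I.prod 𝓘(ℝ, F →L[ℝ] ℂ)) ∞
    (fun p => Bundle.TotalSpace.mk' (F →L[ℝ] ℂ)
      (E := fun p : M => TangentSpace I p →L[ℝ] Bundle.Trivial M ℂ p) p (A p)) S

/-- `β` is a smooth differential 2-form along the subset `S`. -/
def IsSmoothTwoForm (S : Set M) (β : TwoTensor I M) : Prop :=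
  (∀ p ∈ S, ∀ a, β p a a = 0) ∧
  ContMDiffOn I (I.prod 𝓘(ℝ, F →L[ℝ] F →L[ℝ] ℂ)) ∞
    (fun p => Bundle.TotalSpace.mk' (F →L[ℝ] F →L[ℝ] ℂ)
      (E := fun p : M => TangentSpace I p →L[ℝ] TangentSpace I p →L[ℝ] Bundle.Trivial M ℂ p)
      p (β p)) S

end Forms

/-! ### Hermitian vector bundles with connection

The bases that occur are embedded submanifolds, possibly with boundary, of a product of manifolds
(`Y`, the fibre products `Y ×_Q Y` and `D ×_Q Y`, the disk `D` in the plane).  Such a base is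
given as a subset `S` of an ambient manifold `M`.  A vector bundle over `S` with connection is
given by its fibres, by local frames and by the connection 1-forms in these frames.  All these
data may take arbitrary values at points outside `S`: no condition is imposed there. -/

section Bundles

variable {F : Type*} [NormedAddCommGroup F] [NormedSpace ℝ F] {H : Type*} [TopologicalSpace H]

/-- Fibres, local frames `e` and connection forms `A` (in each frame) with
`∇ e_b = ∑ a, A a b • e_a`; the rank is the number of elements of `ι`. The laws are in
`BundleData.IsHermitianBundle`. -/
structure BundleData (I : ModelWithCorners ℝ F H) (M : Type*) [TopologicalSpace M]
    [ChartedSpace H M] (ι : Type) where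
  /-- the fibre at a point -/
  fiber : M → Type u
  [addCommGroup : ∀ p, AddCommGroup (fiber p)]
  [module : ∀ p, Module ℂ (fiber p)]
  /-- the labels of the local frames -/
  label : Type v
  /-- the (ambient) domain of a local frame -/
  dom : label → Set M
  /-- the local frames -/
  frame : ∀ _ : label, ∀ p, Module.Basis ι ℂ (fiber p)
  /-- the connection forms -/
  conn : label → ι → ι → OneForm I M

attribute [instance] BundleData.addCommGroup BundleData.module

variable {I : ModelWithCorners ℝ F H} {M : Type*} [TopologicalSpace M] [ChartedSpace H M]
  {ι κ : Type} [Fintype ι] [DecidableEq ι] [Fintype κ] [DecidableEq κ]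

/-- The matrix of a fibrewise linear map in local frames. -/
def homMatrix (B : BundleData.{u, v} I M ι) (C : BundleData.{u₁, v₁} I M κ)
    (φ : ∀ p, B.fiber p →ₗ[ℂ] C.fiber p) (l : B.label) (k : C.label) (p : M) : Matrix κ ι ℂ :=
  LinearMap.toMatrix (B.frame l p) (C.frame k p) (φ p)

/-- Over `S`, the family `φ` is an isomorphism of hermitian vector bundles with connection: in
local frames its matrix `g` is smooth and unitary, and `φ (∇ e_b) = ∇ (φ e_b)`, that is
`g A = dg + A' g` on all tangent vectors of `S` (the velocities of smooth curves in `S`). -/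
structure IsHermitianParallelIso (S : Set M) (B : BundleData.{u, v} I M ι)
    (C : BundleData.{u₁, v₁} I M κ) (φ : ∀ p, B.fiber p →ₗ[ℂ] C.fiber p) : Prop where
  smooth : ∀ l k a b, ContMDiffOn I 𝓘(ℝ, ℂ) ∞ (fun p => homMatrix B C φ l k p a b)
    (S ∩ B.dom l ∩ C.dom k)
  unitary : ∀ l k, ∀ p ∈ S ∩ B.dom l ∩ C.dom k,
    (homMatrix B C φ l k p).conjTranspose * homMatrix B C φ l k p = 1 ∧
    homMatrix B C φ l k p * (homMatrix B C φ l k p).conjTranspose = 1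
  parallel : ∀ l k, ∀ (W : Set ℝ) (c : ℝ → M), IsOpen W → ContMDiffOn 𝓘(ℝ, ℝ) I ∞ c W →
    Set.MapsTo c W (S ∩ B.dom l ∩ C.dom k) → ∀ t ∈ W, ∀ a b,
      ∑ d, homMatrix B C φ l k (c t) a d * B.conn l d b (c t) (velocity I c t) =
        deriv (fun s => homMatrix B C φ l k (c s) a b) t +
          ∑ d, C.conn k a d (c t) (velocity I c t) * homMatrix B C φ l k (c t) d b

/-- `B` is a smooth hermitian vector bundle with connection over `S`: the local frames cover `S`,
the connection forms are smooth, the changes of frame are smooth and unitary (so that the frames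
are the orthonormal frames of a hermitian metric) and the connection forms in different frames
define the same connection. The connection itself may or may not be unitary. -/
structure BundleData.IsHermitianBundle [IsManifold I ∞ M] (S : Set M)
    (B : BundleData.{u, v} I M ι) : Prop where
  isOpen_dom : ∀ l, IsOpen (B.dom l)
  cover : S ⊆ ⋃ l, B.dom l
  smooth_conn : ∀ l a b, IsSmoothOneForm I (S ∩ B.dom l) (B.conn l a b)
  compatible : IsHermitianParallelIso S B B (fun _ => LinearMap.id)

/-- The pull-back of a bundle with connection. -/
def BundleData.pullback {F' : Type*} [NormedAddCommGroup F'] [NormedSpace ℝ F'] {H' : Type*}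
    [TopologicalSpace H'] (I' : ModelWithCorners ℝ F' H') {N : Type*} [TopologicalSpace N]
    [ChartedSpace H' N] (f : N → M) (B : BundleData.{u, v} I M ι) :
    BundleData.{u, v} I' N ι where
  fiber q := B.fiber (f q)
  label := B.label
  dom l := f ⁻¹' B.dom l
  frame l q := B.frame l (f q)
  conn l a b q := (B.conn l a b (f q)).comp (mfderiv I' I f q)

/-- The tensor product of two bundles with connection. -/
def BundleData.tensor (B : BundleData.{u, v} I M ι) (C : BundleData.{u₁, v₁} I M κ) :
    BundleData.{max u u₁, max v v₁} I M (ι × κ) where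
  fiber p := B.fiber p ⊗[ℂ] C.fiber p
  label := B.label × C.label
  dom l := B.dom l.1 ∩ C.dom l.2
  frame l p := (B.frame l.1 p).tensorProduct (C.frame l.2 p)
  conn l a b p := (if a.2 = b.2 then B.conn l.1 a.1 b.1 p else 0) +
    (if a.1 = b.1 then C.conn l.2 a.2 b.2 p else 0)

/-- The dual of a bundle with connection. -/
def BundleData.dual (B : BundleData.{u, v} I M ι) : BundleData.{u, v} I M ι where
  fiber p := Module.Dual ℂ (B.fiber p)
  label := B.label
  dom := B.dom
  frame l p := (B.frame l p).dualBasis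
  conn l a b p := - B.conn l b a p

/-- The line bundle `B` with connection over `S` has curvature `β`: the pull-backs of `dA` and of
`β` along every smooth surface in `S` agree, where `A` is the connection form in any of the
frames. -/
def HasCurvature (S : Set M) (B : BundleData.{u, v} I M Unit)
    (β : ∀ p : M, TangentSpace I p → TangentSpace I p → ℂ) : Prop :=
  ∀ l, ∀ (W : Set (ℝ × ℝ)) (P : ℝ × ℝ → M), IsOpen W → ContMDiffOn 𝓘(ℝ, ℝ × ℝ) I ∞ P W →
    Set.MapsTo P W (S ∩ B.dom l) → ∀ z ∈ W,
      fderiv ℝ (fun y => B.conn l () () (P y) (mfderiv 𝓘(ℝ, ℝ × ℝ) I P y ((0, 1) : ℝ × ℝ))) z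
          (1, 0) -
        fderiv ℝ (fun y => B.conn l () () (P y) (mfderiv 𝓘(ℝ, ℝ × ℝ) I P y ((1, 0) : ℝ × ℝ))) z
          (0, 1) =
      β (P z) (mfderiv 𝓘(ℝ, ℝ × ℝ) I P z ((1, 0) : ℝ × ℝ))
        (mfderiv 𝓘(ℝ, ℝ × ℝ) I P z ((0, 1) : ℝ × ℝ))

/-- `ψ` is a parallel section of `B` along the curve `c`: its components in every frame satisfy
`x_a' + ∑ b, A a b (c') x_b = 0`. -/
def BundleData.IsParallelAlong (B : BundleData.{u, v} I M ι) (c : ℝ → M)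
    (ψ : ℝ → Σ p, B.fiber p) : Prop :=
  (∀ t, (ψ t).1 = c t) ∧
  ∀ l t, c t ∈ B.dom l → ∀ a,
    HasDerivAt (fun s => (B.frame l (ψ s).1).repr (ψ s).2 a)
      (- ∑ b, B.conn l a b (c t) (velocity I c t) * (B.frame l (ψ t).1).repr (ψ t).2 b) t

/-- `h` is the holonomy of `B` along the closed curve `c` with `c T = c 0`: parallel transport
from time `0` to time `T`. -/
def BundleData.IsHolonomy (B : BundleData.{u, v} I M ι) (c : ℝ → M) (T : ℝ)
    (h : B.fiber (c 0) →ₗ[ℂ] B.fiber (c 0)) : Prop :=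
  ∀ x, ∃ ψ, B.IsParallelAlong c ψ ∧ ψ 0 = ⟨c 0, x⟩ ∧ ψ T = ⟨c 0, h x⟩

open Classical in
/-- The holonomy of `B` along the closed curve `c` with `c T = c 0`. -/
def BundleData.hol (B : BundleData.{u, v} I M ι) (c : ℝ → M) (T : ℝ) :
    B.fiber (c 0) →ₗ[ℂ] B.fiber (c 0) :=
  if h : ∃ h, B.IsHolonomy c T h then h.choose else 0

end Bundles

/-! ### Bundle gerbes with connection and curving, and their modules -/

section Gerbes

variable {EQ : Type*} [NormedAddCommGroup EQ] [NormedSpace ℝ EQ]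
  {EY : Type*} [NormedAddCommGroup EY] [NormedSpace ℝ EY]
  {Q : Type*} [TopologicalSpace Q] [ChartedSpace EQ Q]
  {Y : Type*} [TopologicalSpace Y] [ChartedSpace EY Y] [IsManifold 𝓘(ℝ, EY) ∞ Y]

/-- The fibre product `Y ×_Q Y`. -/
def fiberSquare (π : Y → Q) : Set (Y × Y) := {p | π p.1 = π p.2}

/-- The triple fibre product `Y ×_Q Y ×_Q Y`. -/
def fiberCube (π : Y → Q) : Set (Y × Y × Y) := {p | π p.1 = π p.2.1 ∧ π p.2.1 = π p.2.2}

/-- The model with corners of `Y × Y`. -/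
abbrev model₂ (EY : Type*) [NormedAddCommGroup EY] [NormedSpace ℝ EY] :=
  (𝓘(ℝ, EY)).prod 𝓘(ℝ, EY)

/-- The model with corners of `Y × Y × Y`. -/
abbrev model₃ (EY : Type*) [NormedAddCommGroup EY] [NormedSpace ℝ EY] :=
  (𝓘(ℝ, EY)).prod (model₂ EY)

/-- The 2-form `f_{y₁} - f_{y₂}` at `(y₁, y₂)`. -/
def deltaForm (f : TwoTensor 𝓘(ℝ, EY) Y) (p : Y × Y) (a b : TangentSpace (model₂ EY) p) : ℂ :=
  f p.1 (mfderiv (model₂ EY) 𝓘(ℝ, EY) Prod.fst p a) (mfderiv (model₂ EY) 𝓘(ℝ, EY) Prod.fst p b) -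
  f p.2 (mfderiv (model₂ EY) 𝓘(ℝ, EY) Prod.snd p a) (mfderiv (model₂ EY) 𝓘(ℝ, EY) Prod.snd p b)

variable (EY) in
/-- A (hermitian) bundle gerbe for `π : Y → Q` with bundle gerbe connection and curving: a
hermitian line bundle `L` with connection over `Y ×_Q Y`, an associative product
`L (y₁, y₂) ⊗ L (y₂, y₃) ≅ L (y₁, y₃)` that is a smooth hermitian isomorphism and preserves the
connections, and a 2-form `f` on `Y` such that `L` has curvature `f_{y₁} - f_{y₂}`. -/
structure BundleGerbe (π : Y → Q) where
  /-- the line bundle `L` with its connection -/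
  line : BundleData.{u, v} (model₂ EY) (Y × Y) Unit
  isHermitianBundle : line.IsHermitianBundle (fiberSquare π)
  /-- the product -/
  mul : ∀ p : Y × Y × Y, line.fiber (p.1, p.2.1) ⊗[ℂ] line.fiber (p.2.1, p.2.2) →ₗ[ℂ]
    line.fiber (p.1, p.2.2)
  mul_iso : IsHermitianParallelIso (fiberCube π)
    ((line.pullback (model₃ EY) (fun p : Y × Y × Y => (p.1, p.2.1))).tensor
      (line.pullback (model₃ EY) (fun p : Y × Y × Y => (p.2.1, p.2.2))))
    (line.pullback (model₃ EY) (fun p : Y × Y × Y => (p.1, p.2.2))) mul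
  mul_assoc : ∀ y₁ y₂ y₃ y₄, π y₁ = π y₂ → π y₂ = π y₃ → π y₃ = π y₄ →
    ∀ (a : line.fiber (y₁, y₂)) (b : line.fiber (y₂, y₃)) (c : line.fiber (y₃, y₄)),
      mul (y₁, y₃, y₄) (mul (y₁, y₂, y₃) (a ⊗ₜ b) ⊗ₜ c) =
        mul (y₁, y₂, y₄) (a ⊗ₜ mul (y₂, y₃, y₄) (b ⊗ₜ c))
  /-- the curving `f` -/
  curving : TwoTensor 𝓘(ℝ, EY) Y
  curving_smooth : IsSmoothTwoForm 𝓘(ℝ, EY) Set.univ curving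
  curving_eq : HasCurvature (fiberSquare π) line (deltaForm curving)

/-- A bundle gerbe module of rank `r` with a bundle gerbe module connection: a hermitian vector
bundle `E` over `Y` with connection and a smooth hermitian isomorphism
`L (y₁, y₂) ⊗ E y₂ ≅ E y₁` over `Y ×_Q Y` that is compatible with the bundle gerbe product and
preserves the connections. -/
structure GerbeModule {π : Y → Q} (G : BundleGerbe.{u, v} EY π) (r : ℕ) where
  /-- the vector bundle `E` with its connection `A` -/
  bundle : BundleData.{u₁, v₁} 𝓘(ℝ, EY) Y (Fin r)
  isHermitianBundle : bundle.IsHermitianBundle Set.univ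
  /-- the action of the bundle gerbe -/
  act : ∀ p : Y × Y, G.line.fiber p ⊗[ℂ] bundle.fiber p.2 →ₗ[ℂ] bundle.fiber p.1
  act_iso : IsHermitianParallelIso (fiberSquare π)
    (G.line.tensor (bundle.pullback (model₂ EY) (Prod.snd : Y × Y → Y)))
    (bundle.pullback (model₂ EY) (Prod.fst : Y × Y → Y)) act
  act_mul : ∀ y₁ y₂ y₃, π y₁ = π y₂ → π y₂ = π y₃ →
    ∀ (a : G.line.fiber (y₁, y₂)) (b : G.line.fiber (y₂, y₃)) (e : bundle.fiber y₃),
      act (y₁, y₂) (a ⊗ₜ act (y₂, y₃) (b ⊗ₜ e)) =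
        act (y₁, y₃) (G.mul (y₁, y₂, y₃) (a ⊗ₜ b) ⊗ₜ e)

end Gerbes

/-! ### Maps of a disk, trivialisations and the function `s_A` -/

section Disks

variable {EQ : Type*} [NormedAddCommGroup EQ] [NormedSpace ℝ EQ]
  {EY : Type*} [NormedAddCommGroup EY] [NormedSpace ℝ EY]
  {Q : Type*} [TopologicalSpace Q] [ChartedSpace EQ Q]
  {Y : Type*} [TopologicalSpace Y] [ChartedSpace EY Y] [IsManifold 𝓘(ℝ, EY) ∞ Y]

/-- The closed unit disk `D` in the plane. -/
def disk : Set ℂ := Metric.closedBall 0 1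

/-- The positively oriented boundary circle of `D`, of period `2π`. -/
def boundaryCircle (t : ℝ) : ℂ := Complex.exp (t * Complex.I)

variable (EQ Q) in
/-- The space `D(Q)` of smooth maps `D → Q`. -/
def DiskMap : Type _ :=
  {σ : disk → Q // ∃ s : ℂ → Q, ContMDiffOn 𝓘(ℝ, ℂ) 𝓘(ℝ, EQ) ∞ s disk ∧ ∀ x : disk, s x = σ x}

/-- The pull-back `D ×_Q Y` of `Y` to the disk. -/
def diskPullback (π : Y → Q) (σ : DiskMap EQ Q) : Set (ℂ × Y) :=
  {q | ∃ h : q.1 ∈ disk, π q.2 = σ.1 ⟨q.1, h⟩}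

/-- The fibre square `D ×_Q Y ×_Q Y` of `D ×_Q Y` over the disk. -/
def diskPullbackSquare (π : Y → Q) (σ : DiskMap EQ Q) : Set (ℂ × Y × Y) :=
  {q | ∃ h : q.1 ∈ disk, π q.2.1 = σ.1 ⟨q.1, h⟩ ∧ π q.2.2 = σ.1 ⟨q.1, h⟩}

/-- The model with corners of `ℂ × Y`. -/
abbrev diskModel (EY : Type*) [NormedAddCommGroup EY] [NormedSpace ℝ EY] :=
  (𝓘(ℝ, ℂ)).prod 𝓘(ℝ, EY)

/-- The model with corners of `ℂ × Y × Y`. -/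
abbrev diskModel₂ (EY : Type*) [NormedAddCommGroup EY] [NormedSpace ℝ EY] :=
  (𝓘(ℝ, ℂ)).prod (model₂ EY)

/-- A trivialisation with compatible connection of the pull-back to `D` of the bundle gerbe `G`:
a hermitian line bundle `J` over `D ×_Q Y` with connection `∇_J` and a smooth hermitian isomorphism
`J (x, y₁) ⊗ J (x, y₂)* ≅ L (y₁, y₂)` that preserves the connections and sends the
pairing `J₁ ⊗ J₂* ⊗ J₂ ⊗ J₃* → J₁ ⊗ J₃*` to the bundle gerbe product. -/
structure Trivialisation {π : Y → Q} (G : BundleGerbe.{u, v} EY π) (σ : DiskMap EQ Q) where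
  /-- the line bundle `J` with the connection `∇_J` -/
  line : BundleData.{u₁, v₁} (diskModel EY) (ℂ × Y) Unit
  isHermitianBundle : line.IsHermitianBundle (diskPullback π σ)
  /-- the isomorphism -/
  toGerbe : ∀ q : ℂ × Y × Y,
    line.fiber (q.1, q.2.1) ⊗[ℂ] Module.Dual ℂ (line.fiber (q.1, q.2.2)) →ₗ[ℂ]
      G.line.fiber q.2
  toGerbe_iso : IsHermitianParallelIso (diskPullbackSquare π σ)
    ((line.pullback (diskModel₂ EY) (fun q : ℂ × Y × Y => (q.1, q.2.1))).tensor
      (line.pullback (diskModel₂ EY) (fun q : ℂ × Y × Y => (q.1, q.2.2))).dual)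
    (G.line.pullback (diskModel₂ EY) (fun q : ℂ × Y × Y => q.2)) toGerbe
  toGerbe_mul : ∀ (x : ℂ) (hx : x ∈ disk) (y₁ y₂ y₃ : Y),
    π y₁ = σ.1 ⟨x, hx⟩ → π y₂ = σ.1 ⟨x, hx⟩ → π y₃ = σ.1 ⟨x, hx⟩ →
    ∀ (j₁ : line.fiber (x, y₁)) (η₂ : Module.Dual ℂ (line.fiber (x, y₂)))
      (j₂ : line.fiber (x, y₂)) (η₃ : Module.Dual ℂ (line.fiber (x, y₃))),
      G.mul (y₁, y₂, y₃) (toGerbe (x, y₁, y₂) (j₁ ⊗ₜ η₂) ⊗ₜ toGerbe (x, y₂, y₃) (j₂ ⊗ₜ η₃)) =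
        η₂ j₂ • toGerbe (x, y₁, y₃) (j₁ ⊗ₜ η₃)

/-- The 2-form `f - π^* μ` on `D ×_Q Y`. -/
def curvingSub (f : TwoTensor 𝓘(ℝ, EY) Y) (μ : TwoTensor 𝓘(ℝ, ℂ) ℂ) (q : ℂ × Y)
    (a b : TangentSpace (diskModel EY) q) : ℂ :=
  f q.2 (mfderiv (diskModel EY) 𝓘(ℝ, EY) Prod.snd q a)
    (mfderiv (diskModel EY) 𝓘(ℝ, EY) Prod.snd q b) -
  μ q.1 (mfderiv (diskModel EY) 𝓘(ℝ, ℂ) Prod.fst q a)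
    (mfderiv (diskModel EY) 𝓘(ℝ, ℂ) Prod.fst q b)

/-- `μ` is the 2-form `μ_J` on `D` with `f - F_J = π^* μ_J` on `D ×_Q Y`, where `F_J` is the
curvature of `∇_J`. -/
def Trivialisation.IsCurvingDefect {π : Y → Q} {G : BundleGerbe.{u, v} EY π} {σ : DiskMap EQ Q}
    (J : Trivialisation.{u, v, u₂, v₂} G σ) (μ : TwoTensor 𝓘(ℝ, ℂ) ℂ) : Prop :=
  IsSmoothTwoForm 𝓘(ℝ, ℂ) disk μ ∧
    HasCurvature (diskPullback π σ) J.line (curvingSub G.curving μ)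

/-- The pairing `e ⊗ η ↦ η j • e`, `E ⊗ J* → E`. -/
def contract (V : Type*) {N : Type*} [AddCommGroup V] [Module ℂ V] [AddCommGroup N]
    [Module ℂ N] (j : N) : V ⊗[ℂ] Module.Dual ℂ N →ₗ[ℂ] V :=
  TensorProduct.lift (LinearMap.mk₂ ℂ (fun (e : V) (η : Module.Dual ℂ N) => η j • e)
    (fun _ _ _ => smul_add _ _ _) (fun _ _ _ => smul_comm _ _ _)
    (fun _ _ _ => by simp [add_smul]) (fun _ _ _ => by simp [mul_smul]))

/-- For `j` in `J (x, y₁)`, the map `e ⊗ η ↦ (j ⊗ η) • e`, `E y₂ ⊗ J (x, y₂)* → E y₁`,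
given by `J (x, y₁) ⊗ J (x, y₂)* ≅ L (y₁, y₂)` and by the action of `L` on `E`. -/
def transfer {π : Y → Q} {G : BundleGerbe.{u, v} EY π} {r : ℕ} (E : GerbeModule.{u, v, u₁, v₁} G r)
    {σ : DiskMap EQ Q} (J : Trivialisation.{u, v, u₂, v₂} G σ) (x : ℂ) (y₁ y₂ : Y)
    (j : J.line.fiber (x, y₁)) :
    E.bundle.fiber y₂ ⊗[ℂ] Module.Dual ℂ (J.line.fiber (x, y₂)) →ₗ[ℂ]
      E.bundle.fiber y₁ :=
  TensorProduct.lift (LinearMap.mk₂ ℂ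
    (fun (e : E.bundle.fiber y₂) (η : Module.Dual ℂ (J.line.fiber (x, y₂))) =>
      E.act (y₁, y₂) (J.toGerbe (x, y₁, y₂) (j ⊗ₜ η) ⊗ₜ e))
    (fun _ _ _ => by simp [TensorProduct.tmul_add])
    (fun _ _ _ => by simp)
    (fun _ _ _ => by simp [TensorProduct.tmul_add, TensorProduct.add_tmul])
    (fun _ _ _ => by
      rw [TensorProduct.tmul_smul, map_smul, ← TensorProduct.smul_tmul', map_smul]))

/-- The descent of `E ⊗ J*`, with the connection induced by `A` and `∇_J`, to a hermitian bundle
`E_J` with connection `D_J` over `D`: an isomorphism over `D ×_Q Y` of the pull-back of `E_J` with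
`E ⊗ J*` that preserves the connections and is compatible with the identifications
`E y₂ ⊗ J (x, y₂)* ≅ E y₁ ⊗ J (x, y₁)*` given by `E y₁ ≅ L (y₁, y₂) ⊗ E y₂` and
`L (y₁, y₂) ≅ J (x, y₁) ⊗ J (x, y₂)*`. -/
structure Descent {π : Y → Q} {G : BundleGerbe.{u, v} EY π} {r : ℕ} (E : GerbeModule.{u, v, u₁, v₁} G r)
    {σ : DiskMap EQ Q} (J : Trivialisation.{u, v, u₂, v₂} G σ) where
  /-- the bundle `E_J` with the connection `D_J` -/
  bundle : BundleData.{u₃, v₃} 𝓘(ℝ, ℂ) ℂ (Fin r)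
  isHermitianBundle : bundle.IsHermitianBundle disk
  /-- the isomorphism -/
  toTensor : ∀ q : ℂ × Y, bundle.fiber q.1 →ₗ[ℂ]
    E.bundle.fiber q.2 ⊗[ℂ] Module.Dual ℂ (J.line.fiber q)
  toTensor_iso : IsHermitianParallelIso (diskPullback π σ)
    (bundle.pullback (diskModel EY) (Prod.fst : ℂ × Y → ℂ))
    ((E.bundle.pullback (diskModel EY) (Prod.snd : ℂ × Y → Y)).tensor J.line.dual) toTensor
  compatible : ∀ (x : ℂ) (hx : x ∈ disk) (y₁ y₂ : Y),
    π y₁ = σ.1 ⟨x, hx⟩ → π y₂ = σ.1 ⟨x, hx⟩ →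
    ∀ (a : bundle.fiber x) (j : J.line.fiber (x, y₁)),
      contract (E.bundle.fiber y₁) j (toTensor (x, y₁) a) =
        transfer E J x y₁ y₂ j (toTensor (x, y₂) a)

/-- The number `tr hol(D_J) · exp (∫_D μ_J)`, with the holonomy around the boundary of `D`. -/
def sValue {r : ℕ} (B : BundleData.{u₁, v₁} 𝓘(ℝ, ℂ) ℂ (Fin r)) (μ : TwoTensor 𝓘(ℝ, ℂ) ℂ) : ℂ :=
  LinearMap.trace ℂ _ (B.hol boundaryCircle (2 * Real.pi)) *
    Complex.exp (∫ z in disk, μ z (1 : ℂ) (Complex.I : ℂ))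

end Disks

end BundleGerbes

end

open BundleGerbes

namespace BundleGerbes
open Set Filter Topology

noncomputable section

/-! ### Scalar analysis in the plane -/

/-! Two trivialisations `J`, `J'` over the same disk map differ by a line bundle with connection `K`
on the disk, the descent of `J' ⊗ J*`, and `E_J ≅ E_{J'} ⊗ K`. The curvature of `K` is `F_{J'} - F_J
= μ - μ'`, since the curving `f` cancels. Hence the holonomy of `K` around the boundary is `exp (-∫
(μ - μ'))`, which is exactly the factor by which `exp (∫ μ')` and `exp (∫ μ)` differ.

The line `K` is never constructed. A `Comparison` picks in each fibre a nonzero element `ρ x` of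
`K`, with no regularity in `x`; a section of `K` is then a scalar function `u`, standing for `u •
ρ`. Calculus becomes possible after multiplication by the coefficient `g` along a smooth lift to `D
×_Q Y`, and `Comparison.HasLogDeriv` states the covariant derivative in this way. It suffices to
test one lift, because by `Comparison.hasDerivAt_g_div` the connection of `L` cancels when the lift
or the frames change.

The holonomy of `K` is computed in `Comparison.exists_parallel`. Pull `K` back to the plane along
`(s, t) ↦ sin s • exp (i t)`, so that all of the plane, including a neighbourhood of `s = π/2`, is
mapped into the disk. Let `a` be the integral of the curvature coefficient from `0` to `s`.
Subtracting `a dt` makes the connection flat, so there are flat sections on boxes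
(`exists_primitive_box`), and these glue over the plane (`exists_global_of_local`). The line `s = 0`
is collapsed to the centre, which forces the flat section to be `2π`-periodic in `t`. Along `s =
π/2` it becomes parallel after multiplication by `exp (-∫ a dt)`, and the monodromy is read off;
`integral_disk_eq` identifies it with integrals over the disk.

A parallel section `w` of `K` turns parallel sections of `E_{J'}` into those of `E_J`
(`Comparison.isParallelAlong`), so the holonomies are conjugate up to the monodromy of `w`.
Existence of parallel transport is not needed: holonomies are carried over in both directions, so
either both exist or neither does, and uniqueness fixes the value of `hol`. -/

/-- A property of intervals that is local and stable under gluing holds for all intervals. -/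
lemma forall_interval_of_local_of_glue {G : ℝ → ℝ → Prop}
    (mono : ∀ a b a' b', a ≤ a' → b' ≤ b → G a b → G a' b')
    (glue : ∀ a b c d, a < c → c < b → b < d → G a b → G c d → G a d)
    (loc : ∀ t, ∃ δ > 0, G (t - δ) (t + δ)) (a b : ℝ) : G a b := by
  wlog hab : a < b generalizing a b
  · exact mono (b - 1) (a + 1) a b (by linarith) (by linarith) (this _ _ (by linarith))
  -- Supremum argument: `T` collects the points of `[a, b]` that good intervals from `a` reach past.
  -- A good neighbourhood of `sSup T` pushes the supremum further unless it already covers `b`.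
  let T : Set ℝ := {x | x ∈ Icc a b ∧ ∃ y > x, G a y}
  have haT : a ∈ T := by
    obtain ⟨δ, hδ, h⟩ := loc a
    exact ⟨⟨le_rfl, hab.le⟩, a + δ, by linarith, mono _ _ _ _ (by linarith) le_rfl h⟩
  have hbdd : BddAbove T := ⟨b, fun x hx => hx.1.2⟩
  obtain ⟨δ, hδ, h⟩ := loc (sSup T)
  obtain ⟨x, hxT, hx⟩ := exists_lt_of_lt_csSup ⟨a, haT⟩ (sub_lt_self (sSup T) hδ)
  obtain ⟨y, hy, hG⟩ := hxT.2
  have hac : a ≤ sSup T := le_csSup hbdd haT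
  have key : G a (sSup T + δ) := by
    rcases le_or_gt (sSup T - δ) a with h1 | h1
    · exact mono _ _ _ _ h1 le_rfl h
    rcases le_or_gt (sSup T + δ) y with h2 | h2
    · exact mono _ _ _ _ le_rfl h2 hG
    · exact glue _ _ _ _ h1 (hx.trans hy) h2 hG h
  rcases le_or_gt b (sSup T + δ) with h1 | h1
  · exact mono _ _ _ _ le_rfl h1 key
  · have : sSup T + δ / 2 ∈ T :=
      ⟨⟨by linarith, by linarith⟩, sSup T + δ, by linarith, key⟩
    linarith [le_csSup hbdd this]

lemma eq_of_hasDerivAt_zero_Ioo {f : ℝ → ℂ} {a b : ℝ} (h : ∀ x ∈ Ioo a b, HasDerivAt f 0 x)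
    {x y : ℝ} (hx : x ∈ Ioo a b) (hy : y ∈ Ioo a b) : f x = f y :=
  isOpen_Ioo.is_const_of_deriv_eq_zero isPreconnected_Ioo
    (fun x hx => (h x hx).differentiableAt.differentiableWithinAt)
    (fun x hx => (h x hx).deriv) hx hy

lemma eq_of_hasDerivAt_zero {f : ℝ → ℂ} (h : ∀ x, HasDerivAt f 0 x) (x y : ℝ) : f x = f y :=
  is_const_of_deriv_eq_zero (fun x => (h x).differentiableAt) (fun x => (h x).deriv) x y

lemma eq_of_partial_zero_box {f : ℝ × ℝ → ℂ} {a b c d : ℝ}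
    (h₁ : ∀ z ∈ Ioo a b ×ˢ Ioo c d, HasDerivAt (fun s => f (s, z.2)) 0 z.1)
    (h₂ : ∀ z ∈ Ioo a b ×ˢ Ioo c d, HasDerivAt (fun t => f (z.1, t)) 0 z.2)
    {z w : ℝ × ℝ} (hz : z ∈ Ioo a b ×ˢ Ioo c d) (hw : w ∈ Ioo a b ×ˢ Ioo c d) : f z = f w :=
  calc f z = f (w.1, z.2) :=
        eq_of_hasDerivAt_zero_Ioo (f := fun s => f (s, z.2)) (fun s hs => h₁ (s, z.2) ⟨hs, hz.2⟩)
          hz.1 hw.1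
    _ = f w :=
        eq_of_hasDerivAt_zero_Ioo (f := fun t => f (w.1, t)) (fun t ht => h₂ (w.1, t) ⟨hw.1, ht⟩)
          hz.2 hw.2

/-- Functions that exist locally and are unique up to a nonzero constant on boxes exist
globally on the plane. -/
lemma exists_global_of_local {Sec : (ℝ × ℝ → ℂ) → ℝ × ℝ → Prop}
    (congr : ∀ u v z, u =ᶠ[𝓝 z] v → Sec u z → Sec v z)
    (smul : ∀ (k : ℂ) u z, k ≠ 0 → Sec u z → Sec (fun w => k * u w) z)
    (ne : ∀ u z, Sec u z → u z ≠ 0)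
    (exist : ∀ z, ∃ u, ∀ᶠ w in 𝓝 z, Sec u w)
    (uniq : ∀ u v a b c d, (∀ z ∈ Ioo a b ×ˢ Ioo c d, Sec u z) →
      (∀ z ∈ Ioo a b ×ˢ Ioo c d, Sec v z) →
      ∀ z ∈ Ioo a b ×ˢ Ioo c d, ∀ w ∈ Ioo a b ×ˢ Ioo c d, u z / v z = u w / v w) :
    ∃ u, ∀ z, Sec u z := by
  classical
  let Good (a b c d : ℝ) : Prop := ∃ u, ∀ z ∈ Ioo a b ×ˢ Ioo c d, Sec u z
  have good_mono : ∀ {a b c d a' b' c' d'}, a ≤ a' → b' ≤ b → c ≤ c' → d' ≤ d →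
      Good a b c d → Good a' b' c' d' := by
    rintro a b c d a' b' c' d' h1 h2 h3 h4 ⟨u, hu⟩
    exact ⟨u, fun z hz => hu z ⟨Ioo_subset_Ioo h1 h2 hz.1, Ioo_subset_Ioo h3 h4 hz.2⟩⟩
  have agree : ∀ u v (k : ℝ × ℝ) a b c d, (∀ z ∈ Ioo a b ×ˢ Ioo c d, Sec u z) →
      (∀ z ∈ Ioo a b ×ˢ Ioo c d, Sec v z) → k ∈ Ioo a b ×ˢ Ioo c d →
      ∀ z ∈ Ioo a b ×ˢ Ioo c d, u z = u k / v k * v z := by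
    intro u v k a b c d hu hv hk z hz
    rw [← uniq u v a b c d hu hv z hz k hk, div_mul_cancel₀ _ (ne v z (hv z hz))]
  have good_glue₂ : ∀ {a b c d c' d'}, c < c' → c' < d → d < d' →
      Good a b c d → Good a b c' d' → Good a b c d' := by
    rintro a b c d c' d' h1 h2 h3 ⟨u, hu⟩ ⟨v, hv⟩
    rcases le_or_gt b a with hab | hab
    · exact ⟨u, fun z hz => absurd (hz.1.1.trans hz.1.2) (not_lt.2 hab)⟩
    have hk : ((a + b) / 2, (c' + d) / 2) ∈ Ioo a b ×ˢ Ioo c' d :=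
      ⟨⟨by dsimp; linarith, by dsimp; linarith⟩, ⟨by dsimp; linarith, by dsimp; linarith⟩⟩
    set k : ℝ × ℝ := ((a + b) / 2, (c' + d) / 2)
    have hku : u k ≠ 0 := ne _ _ (hu k ⟨hk.1, h1.trans hk.2.1, hk.2.2⟩)
    have hkv : v k ≠ 0 := ne _ _ (hv k ⟨hk.1, hk.2.1, hk.2.2.trans h3⟩)
    have hag := agree u v k a b c' d (fun z hz => hu z ⟨hz.1, h1.trans hz.2.1, hz.2.2⟩)
      (fun z hz => hv z ⟨hz.1, hz.2.1, hz.2.2.trans h3⟩) hk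
    -- The ratio `u / v` is constant on the overlap, so rescaling `v` by its value at one point `k`
    -- makes the two functions agree there.
    refine ⟨fun z => if z.2 < d then u z else u k / v k * v z, fun z hz => ?_⟩
    rcases lt_or_ge z.2 d with hzd | hzd
    · refine congr u _ z ?_ (hu z ⟨hz.1, hz.2.1, hzd⟩)
      filter_upwards [(isOpen_Iio.preimage continuous_snd).mem_nhds hzd] with w hw
      exact (if_pos hw).symm
    · refine congr _ _ z ?_ (smul _ v z (div_ne_zero hku hkv)
        (hv z ⟨hz.1, h2.trans_le hzd, hz.2.2⟩))
      filter_upwards [(isOpen_Ioo.preimage continuous_fst).mem_nhds hz.1,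
        (isOpen_Ioi.preimage continuous_snd).mem_nhds (h2.trans_le hzd)] with w hw1 hw2
      split_ifs with hw
      · exact (hag w ⟨hw1, hw2, hw⟩).symm
      · rfl
  have good_glue₁ : ∀ {a b a' b' c d}, a < a' → a' < b → b < b' →
      Good a b c d → Good a' b' c d → Good a b' c d := by
    rintro a b a' b' c d h1 h2 h3 ⟨u, hu⟩ ⟨v, hv⟩
    rcases le_or_gt d c with hab | hab
    · exact ⟨u, fun z hz => absurd (hz.2.1.trans hz.2.2) (not_lt.2 hab)⟩
    have hk : ((a' + b) / 2, (c + d) / 2) ∈ Ioo a' b ×ˢ Ioo c d :=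
      ⟨⟨by dsimp; linarith, by dsimp; linarith⟩, ⟨by dsimp; linarith, by dsimp; linarith⟩⟩
    set k : ℝ × ℝ := ((a' + b) / 2, (c + d) / 2)
    have hku : u k ≠ 0 := ne _ _ (hu k ⟨⟨h1.trans hk.1.1, hk.1.2⟩, hk.2⟩)
    have hkv : v k ≠ 0 := ne _ _ (hv k ⟨⟨hk.1.1, hk.1.2.trans h3⟩, hk.2⟩)
    have hag := agree u v k a' b c d (fun z hz => hu z ⟨⟨h1.trans hz.1.1, hz.1.2⟩, hz.2⟩)
      (fun z hz => hv z ⟨⟨hz.1.1, hz.1.2.trans h3⟩, hz.2⟩) hk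
    refine ⟨fun z => if z.1 < b then u z else u k / v k * v z, fun z hz => ?_⟩
    rcases lt_or_ge z.1 b with hzd | hzd
    · refine congr u _ z ?_ (hu z ⟨⟨hz.1.1, hzd⟩, hz.2⟩)
      filter_upwards [(isOpen_Iio.preimage continuous_fst).mem_nhds hzd] with w hw
      exact (if_pos hw).symm
    · refine congr _ _ z ?_ (smul _ v z (div_ne_zero hku hkv)
        (hv z ⟨⟨h2.trans_le hzd, hz.1.2⟩, hz.2⟩))
      filter_upwards [(isOpen_Ioo.preimage continuous_snd).mem_nhds hz.2,
        (isOpen_Ioi.preimage continuous_fst).mem_nhds (h2.trans_le hzd)] with w hw1 hw2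
      split_ifs with hw
      · exact (hag w ⟨⟨hw2, hw⟩, hw1⟩).symm
      · rfl
  have good_loc : ∀ s t, ∃ δ > 0, Good (s - δ) (s + δ) (t - δ) (t + δ) := by
    intro s t
    obtain ⟨u, hu⟩ := exist (s, t)
    obtain ⟨δ, hδ, h⟩ := Metric.eventually_nhds_iff_ball.1 hu
    refine ⟨δ, hδ, u, fun z hz => h z ?_⟩
    rw [← Real.ball_eq_Ioo, ← Real.ball_eq_Ioo, ball_prod_same] at hz
    exact hz
  -- The width `δ` may shrink with the interval: each gluing takes the minimum of two widths. The
  -- strips are afterwards glued in the first variable.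
  have good_strip : ∀ s c d, ∃ δ > 0, Good (s - δ) (s + δ) c d := by
    intro s
    refine forall_interval_of_local_of_glue (G := fun c d => ∃ δ > 0, Good (s - δ) (s + δ) c d)
      ?_ ?_ ?_
    · rintro a b a' b' h1 h2 ⟨δ, hδ, h⟩
      exact ⟨δ, hδ, good_mono le_rfl le_rfl h1 h2 h⟩
    · rintro a b c d h1 h2 h3 ⟨δ, hδ, h⟩ ⟨ε, hε, h'⟩
      have e1 := min_le_left δ ε
      have e2 := min_le_right δ ε
      exact ⟨min δ ε, lt_min hδ hε, good_glue₂ h1 h2 h3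
        (good_mono (by linarith) (by linarith) le_rfl le_rfl h)
        (good_mono (by linarith) (by linarith) le_rfl le_rfl h')⟩
    · intro t
      obtain ⟨δ, hδ, h⟩ := good_loc s t
      exact ⟨δ, hδ, δ, hδ, h⟩
  have good_all : ∀ a b c d, Good a b c d := fun a b c d =>
    forall_interval_of_local_of_glue (G := fun a b => Good a b c d)
      (fun _ _ _ _ h1 h2 h => good_mono h1 h2 le_rfl le_rfl h)
      (fun _ _ _ _ h1 h2 h3 h h' => good_glue₁ h1 h2 h3 h h')
      (fun s => good_strip s c d) a b
  choose u hu using fun n : ℕ => good_all (-(n + 1)) (n + 1) (-(n + 1)) (n + 1)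
  have mem_box : ∀ (z : ℝ × ℝ) (n : ℕ), ‖z‖ < n + 1 →
      z ∈ Ioo (-(n + 1 : ℝ)) (n + 1) ×ˢ Ioo (-(n + 1 : ℝ)) (n + 1) := by
    intro z n h
    exact ⟨abs_lt.1 ((norm_fst_le z).trans_lt h), abs_lt.1 ((norm_snd_le z).trans_lt h)⟩
  have h0 : ∀ n : ℕ, (0 : ℝ × ℝ) ∈ Ioo (-(n + 1 : ℝ)) (n + 1) ×ˢ Ioo (-(n + 1 : ℝ)) (n + 1) :=
    fun n => mem_box 0 n (by rw [norm_zero]; positivity)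
  have hne : ∀ n, u n 0 ≠ 0 := fun n => ne _ _ (hu n 0 (h0 n))
  have hmn : ∀ m n : ℕ, m ≤ n → ∀ z : ℝ × ℝ, ‖z‖ < m + 1 →
      (u m 0)⁻¹ * u m z = (u n 0)⁻¹ * u n z := by
    intro m n hle z hz
    have hle' : (m : ℝ) ≤ n := by exact_mod_cast hle
    have := agree (u m) (u n) 0 _ _ _ _ (hu m) (fun w hw => hu n w
      ⟨Ioo_subset_Ioo (by linarith) (by linarith) hw.1,
        Ioo_subset_Ioo (by linarith) (by linarith) hw.2⟩) (h0 m) z (mem_box z m hz)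
    rw [this]
    field_simp [hne m, hne n]
  -- Normalised to be `1` at the origin, the solutions on nested squares agree, so the index may
  -- depend on the point; near `z` the function equals the one for a fixed large `N`.
  refine ⟨fun z => (u ⌈‖z‖⌉₊ 0)⁻¹ * u ⌈‖z‖⌉₊ z, fun z => ?_⟩
  obtain ⟨N, hN⟩ := exists_nat_gt (‖z‖ + 1)
  refine congr (fun w => (u N 0)⁻¹ * u N w) _ z ?_
    (smul _ _ _ (inv_ne_zero (hne N)) (hu N z (mem_box z N (by linarith))))
  have hev : ∀ᶠ w in 𝓝 z, ‖w‖ < N :=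
    continuous_norm.continuousAt.eventually_lt continuousAt_const (by linarith)
  filter_upwards [hev] with w hw
  exact (hmn _ N (Nat.ceil_le.2 hw.le) w ((Nat.le_ceil _).trans_lt (lt_add_one _))).symm

/-- A planar 1-form `p ds + q dt` with `∂q/∂s - ∂p/∂t = κ`, where `κ = ∂a/∂s`, differs from
`a dt` by an exact form on boxes. -/
lemma exists_primitive_box {p q κ a : ℝ × ℝ → ℂ} {a₁ b₁ a₂ b₂ : ℝ} {z₀ : ℝ × ℝ}
    (hz₀ : z₀ ∈ Ioo a₁ b₁ ×ˢ Ioo a₂ b₂)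
    (hp : ContDiffOn ℝ 1 p (Ioo a₁ b₁ ×ˢ Ioo a₂ b₂))
    (hq : ContDiffOn ℝ 1 q (Ioo a₁ b₁ ×ˢ Ioo a₂ b₂))
    (ha : Continuous a)
    (hax : ∀ z : ℝ × ℝ, HasDerivAt (fun s => a (s, z.2)) (κ z) z.1)
    (hcurl : ∀ z ∈ Ioo a₁ b₁ ×ˢ Ioo a₂ b₂,
      fderiv ℝ q z (1, 0) - fderiv ℝ p z (0, 1) = κ z) :
    ∃ Λ : ℝ × ℝ → ℂ, ∀ z ∈ Ioo a₁ b₁ ×ˢ Ioo a₂ b₂,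
      HasDerivAt (fun s => Λ (s, z.2)) (- p z) z.1 ∧
      HasDerivAt (fun t => Λ (z.1, t)) (a z - q z) z.2 := by
  set U := Ioo a₁ b₁ ×ˢ Ioo a₂ b₂ with hU
  have hUo : IsOpen U := isOpen_Ioo.prod isOpen_Ioo
  have hpart₂ : ∀ f : ℝ × ℝ → ℂ, ContDiffOn ℝ 1 f U → ∀ z ∈ U,
      HasDerivAt (fun t => f (z.1, t)) (fderiv ℝ f z (0, 1)) z.2 := by
    intro f hf z hz
    have h1 := (((hf.differentiableOn one_ne_zero) z hz).differentiableAt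
      (hUo.mem_nhds hz)).hasFDerivAt
    exact HasFDerivAt.comp_hasDerivAt (f := fun t : ℝ => (z.1, t)) z.2 h1
      ((hasDerivAt_const _ _).prodMk (hasDerivAt_id _))
  have hpart₁ : ∀ f : ℝ × ℝ → ℂ, ContDiffOn ℝ 1 f U → ∀ z ∈ U,
      HasDerivAt (fun s => f (s, z.2)) (fderiv ℝ f z (1, 0)) z.1 := by
    intro f hf z hz
    have h1 := (((hf.differentiableOn one_ne_zero) z hz).differentiableAt
      (hUo.mem_nhds hz)).hasFDerivAt
    exact HasFDerivAt.comp_hasDerivAt (f := fun s : ℝ => (s, z.2)) z.1 h1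
      ((hasDerivAt_id _).prodMk (hasDerivAt_const _ _))
  have hpc := hp.continuousOn
  have hqc := hq.continuousOn
  have hdp : ContinuousOn (fun z => fderiv ℝ p z (0, 1)) U :=
    (hp.continuousOn_fderiv_of_isOpen hUo le_rfl).clm_apply continuousOn_const
  have hdq : ContinuousOn (fun z => fderiv ℝ q z (1, 0)) U :=
    (hq.continuousOn_fderiv_of_isOpen hUo le_rfl).clm_apply continuousOn_const
  have hsub : ∀ s ∈ Ioo a₁ b₁, uIcc z₀.1 s ⊆ Ioo a₁ b₁ := fun s hs =>
    ordConnected_Ioo.uIcc_subset hz₀.1 hs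
  have hsub₂ : ∀ t ∈ Ioo a₂ b₂, uIcc z₀.2 t ⊆ Ioo a₂ b₂ := fun s hs =>
    ordConnected_Ioo.uIcc_subset hz₀.2 hs
  let b : ℝ → ℂ := fun t => a (z₀.1, t) - q (z₀.1, t)
  have hb : ContinuousOn b (Ioo a₂ b₂) :=
    (ha.comp (by fun_prop)).continuousOn.sub
      (hqc.comp (by fun_prop) fun t ht => ⟨hz₀.1, ht⟩)
  -- Integrate `a - q` vertically through `z₀`, then `-p` horizontally. In the `t`-derivative,
  -- differentiation under the integral sign and `∂p/∂t = ∂(q - a)/∂s` reduce the integral to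
  -- boundary terms.
  refine ⟨fun z => (∫ t in z₀.2..z.2, b t) - ∫ s in z₀.1..z.1, p (s, z.2), fun z hz => ⟨?_, ?_⟩⟩
  · have hc : ContinuousOn (fun s => p (s, z.2)) (Ioo a₁ b₁) :=
      hpc.comp (by fun_prop) fun s hs => ⟨hs, hz.2⟩
    have := intervalIntegral.integral_hasDerivAt_right
      ((hc.mono (hsub _ hz.1)).intervalIntegrable)
      (hc.stronglyMeasurableAtFilter isOpen_Ioo _ hz.1) (hc.continuousAt (isOpen_Ioo.mem_nhds hz.1))
    exact this.const_sub (∫ t in z₀.2..z.2, b t)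
  · have h1 := intervalIntegral.integral_hasDerivAt_right
      ((hb.mono (hsub₂ _ hz.2)).intervalIntegrable)
      (hb.stronglyMeasurableAtFilter isOpen_Ioo _ hz.2) (hb.continuousAt (isOpen_Ioo.mem_nhds hz.2))
    obtain ⟨ε, hε, hball⟩ := Metric.nhds_basis_closedBall.mem_iff.1 (isOpen_Ioo.mem_nhds hz.2)
    have hK : IsCompact (uIcc z₀.1 z.1 ×ˢ Metric.closedBall z.2 ε) :=
      isCompact_uIcc.prod (isCompact_closedBall _ _)
    have hKU : uIcc z₀.1 z.1 ×ˢ Metric.closedBall z.2 ε ⊆ U :=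
      prod_mono (hsub _ hz.1) hball
    obtain ⟨C, hC⟩ := hK.exists_bound_of_continuousOn (hdp.mono hKU)
    have hline : ∀ t ∈ Ioo a₂ b₂, ContinuousOn (fun s => p (s, t)) (uIcc z₀.1 z.1) := fun t ht =>
      (hpc.comp (by fun_prop) fun s hs => ⟨hs, ht⟩ : ContinuousOn (fun s => p (s, t))
        (Ioo a₁ b₁)).mono (hsub _ hz.1)
    have hdline : ContinuousOn (fun s => fderiv ℝ p (s, z.2) (0, 1)) (uIcc z₀.1 z.1) :=
      hdp.comp (f := fun s : ℝ => (s, z.2)) (by fun_prop) fun s hs => ⟨hsub _ hz.1 hs, hz.2⟩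
    have hdqline : ContinuousOn (fun s => fderiv ℝ q (s, z.2) (1, 0)) (uIcc z₀.1 z.1) :=
      hdq.comp (f := fun s : ℝ => (s, z.2)) (by fun_prop) fun s hs => ⟨hsub _ hz.1 hs, hz.2⟩
    have h2 := (intervalIntegral.hasDerivAt_integral_of_dominated_loc_of_deriv_le
      (μ := MeasureTheory.volume) (a := z₀.1) (b := z.1) (F := fun t s => p (s, t))
      (F' := fun t s => fderiv ℝ p (s, t) (0, 1)) (x₀ := z.2) (s := Metric.closedBall z.2 ε)
      (bound := fun _ => C) (Metric.closedBall_mem_nhds _ hε)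
      (by
        filter_upwards [isOpen_Ioo.mem_nhds hz.2] with t ht
        exact ((hline t ht).mono uIoc_subset_uIcc).aestronglyMeasurable measurableSet_uIoc)
      (hline _ hz.2).intervalIntegrable
      ((hdline.mono uIoc_subset_uIcc).aestronglyMeasurable measurableSet_uIoc)
      (Eventually.of_forall fun s hs t ht => hC (s, t) ⟨uIoc_subset_uIcc hs, ht⟩)
      intervalIntegrable_const
      (Eventually.of_forall fun s hs t ht =>
        hpart₂ p hp (s, t) ⟨hsub _ hz.1 (uIoc_subset_uIcc hs), hball ht⟩)).2
    have h3 : ∫ s in z₀.1..z.1, fderiv ℝ p (s, z.2) (0, 1) =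
        (q z - a z) - (q (z₀.1, z.2) - a (z₀.1, z.2)) := by
      refine intervalIntegral.integral_eq_sub_of_hasDerivAt
        (f := fun s => q (s, z.2) - a (s, z.2)) ?_ hdline.intervalIntegrable
      intro s hs
      have hsU : (s, z.2) ∈ U := ⟨hsub _ hz.1 hs, hz.2⟩
      have := (hpart₁ q hq (s, z.2) hsU).sub (hax (s, z.2))
      rw [← hcurl _ hsU, sub_sub_cancel] at this
      exact this
    have := h1.sub h2
    rw [h3] at this
    refine this.congr_deriv ?_
    simp only [b]
    ring

/-! ### Velocities, pull-backs of forms and local sections of submersions -/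

section Forms

variable {F : Type*} [NormedAddCommGroup F] [NormedSpace ℝ F] {H : Type*} [TopologicalSpace H]
  {I : ModelWithCorners ℝ F H} {M : Type*} [TopologicalSpace M] [ChartedSpace H M]
  {F' : Type*} [NormedAddCommGroup F'] [NormedSpace ℝ F'] {H' : Type*} [TopologicalSpace H']
  {I' : ModelWithCorners ℝ F' H'} {N : Type*} [TopologicalSpace N] [ChartedSpace H' N]

lemma mfderiv_velocity {c : ℝ → M} {f : M → N} {t : ℝ} (hf : MDifferentiableAt I I' f (c t))
    (hc : MDifferentiableAt 𝓘(ℝ, ℝ) I c t) :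
    mfderiv I I' f (c t) (velocity I c t) = velocity I' (fun s => f (c s)) t := by
  have := mfderiv_comp t hf hc
  unfold velocity
  change _ = mfderiv 𝓘(ℝ, ℝ) I' (f ∘ c) t (1 : ℝ)
  rw [this]
  rfl

lemma velocity_fst_line {γ : ℝ × ℝ → M} {z : ℝ × ℝ}
    (hγ : MDifferentiableAt 𝓘(ℝ, ℝ × ℝ) I γ z) :
    velocity I (fun s => γ (s, z.2)) z.1 = mfderiv 𝓘(ℝ, ℝ × ℝ) I γ z ((1, 0) : ℝ × ℝ) := by
  have h1 : HasDerivAt (fun s : ℝ => (s, z.2)) ((1, 0) : ℝ × ℝ) z.1 :=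
    (hasDerivAt_id _).prodMk (hasDerivAt_const _ _)
  rw [← mfderiv_velocity (c := fun s : ℝ => (s, z.2)) (I := 𝓘(ℝ, ℝ × ℝ)) hγ
    h1.differentiableAt.mdifferentiableAt]
  unfold velocity
  rw [mfderiv_eq_fderiv, ← h1.deriv]
  rfl

lemma velocity_snd_line {γ : ℝ × ℝ → M} {z : ℝ × ℝ}
    (hγ : MDifferentiableAt 𝓘(ℝ, ℝ × ℝ) I γ z) :
    velocity I (fun t => γ (z.1, t)) z.2 = mfderiv 𝓘(ℝ, ℝ × ℝ) I γ z ((0, 1) : ℝ × ℝ) := by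
  have h1 : HasDerivAt (fun t : ℝ => (z.1, t)) ((0, 1) : ℝ × ℝ) z.2 :=
    (hasDerivAt_const _ _).prodMk (hasDerivAt_id _)
  rw [← mfderiv_velocity (c := fun t : ℝ => (z.1, t)) (I := 𝓘(ℝ, ℝ × ℝ)) hγ
    h1.differentiableAt.mdifferentiableAt]
  unfold velocity
  rw [mfderiv_eq_fderiv, ← h1.deriv]
  rfl

lemma velocity_const (p : M) (t : ℝ) : velocity I (fun _ : ℝ => p) t = 0 := by
  unfold velocity
  rw [mfderiv_const]
  rfl

variable {V : Type*} [NormedAddCommGroup V] [NormedSpace ℝ V]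

lemma contDiffOn_snd_trivial {γ : V → M} {W : Set V} {h : V → ℂ}
    (hh : ContMDiffOn 𝓘(ℝ, V) (I.prod 𝓘(ℝ, ℂ)) ∞
      (fun w => Bundle.TotalSpace.mk' ℂ (E := Bundle.Trivial M ℂ) (γ w) (h w)) W) :
    ContDiffOn ℝ ∞ h W := by
  intro w hw
  have := (Bundle.contMDiffWithinAt_totalSpace.1 (hh w hw)).2
  exact this.contDiffWithinAt

variable [IsManifold I ∞ M]

lemma contMDiffOn_mfderiv_apply {γ : V → M} {W : Set V} (hW : IsOpen W)
    (hγ : ContMDiffOn 𝓘(ℝ, V) I ∞ γ W) (v : V) :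
    ContMDiffOn 𝓘(ℝ, V) (I.prod 𝓘(ℝ, F)) ∞
      (fun w => Bundle.TotalSpace.mk' F (E := (TangentSpace I : M → Type _)) (γ w)
        (mfderiv 𝓘(ℝ, V) I γ w v)) W := by
  have : IsManifold I 1 M := IsManifold.of_le (m := 1) (n := ∞) (by simp)
  have h1 := hγ.contMDiffOn_tangentMapWithin (m := ∞) (by simp) hW.uniqueMDiffOn
  have h2 : ContMDiffOn 𝓘(ℝ, V) (𝓘(ℝ, V).prod 𝓘(ℝ, V)) ∞
      (fun w : V => (⟨w, v⟩ : TangentBundle 𝓘(ℝ, V) V)) W :=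
    contMDiffOn_vectorSpace_iff_contDiffOn (V := fun _ => v).2 contDiffOn_const
  refine (h1.comp h2 fun w hw => hw).congr fun w hw => ?_
  simp only [Function.comp, tangentMapWithin, mfderivWithin_of_isOpen hW hw]

lemma IsSmoothOneForm.contDiffOn_pullback {S : Set M} {A : OneForm I M}
    (hA : IsSmoothOneForm I S A) {γ : V → M} {W : Set V} (hW : IsOpen W)
    (hγ : ContMDiffOn 𝓘(ℝ, V) I ∞ γ W) (hS : MapsTo γ W S) (v : V) :
    ContDiffOn ℝ ∞ (fun w => A (γ w) (mfderiv 𝓘(ℝ, V) I γ w v)) W := by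
  have h1 := ContMDiffOn.comp (M' := M) (I' := I) hA hγ hS
  exact contDiffOn_snd_trivial
    (ContMDiffOn.clm_bundle_apply (E₂ := Bundle.Trivial M ℂ) h1 (contMDiffOn_mfderiv_apply hW hγ v))

lemma IsSmoothTwoForm.contDiffOn_pullback {S : Set M} {β : TwoTensor I M}
    (hβ : IsSmoothTwoForm I S β) {γ : V → M} {W : Set V} (hW : IsOpen W)
    (hγ : ContMDiffOn 𝓘(ℝ, V) I ∞ γ W) (hS : MapsTo γ W S) (v v' : V) :
    ContDiffOn ℝ ∞ (fun w => β (γ w) (mfderiv 𝓘(ℝ, V) I γ w v) (mfderiv 𝓘(ℝ, V) I γ w v')) W := by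
  have h1 := ContMDiffOn.comp (M' := M) (I' := I) hβ.2 hγ hS
  exact contDiffOn_snd_trivial
    (ContMDiffOn.clm_bundle_apply₂ (E₃ := Bundle.Trivial M ℂ) h1
      (contMDiffOn_mfderiv_apply hW hγ v) (contMDiffOn_mfderiv_apply hW hγ v'))

lemma IsSmoothTwoForm.continuousOn_apply {S : Set ℂ} {β : TwoTensor 𝓘(ℝ, ℂ) ℂ}
    (hβ : IsSmoothTwoForm 𝓘(ℝ, ℂ) S β) (v v' : ℂ) : ContinuousOn (fun z => β z v v') S := by
  have h (v : ℂ) : ContMDiffOn 𝓘(ℝ, ℂ) (𝓘(ℝ, ℂ).prod 𝓘(ℝ, ℂ)) ∞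
      (fun w : ℂ => (⟨w, v⟩ : TangentBundle 𝓘(ℝ, ℂ) ℂ)) S :=
    contMDiffOn_vectorSpace_iff_contDiffOn (V := fun _ => v).2 contDiffOn_const
  exact (contDiffOn_snd_trivial
    (ContMDiffOn.clm_bundle_apply₂ (E₃ := Bundle.Trivial ℂ ℂ) hβ.2 (h v) (h v'))).continuousOn

/-- An alternating form evaluated on an orthogonal pair `(a e, b i e)` with `e` on the circle. -/
lemma alternating_polar (β : ℂ →L[ℝ] ℂ →L[ℝ] ℂ) (hβ : ∀ a, β a a = 0) (e : ℂ)
    (he : ‖e‖ = 1) (a b : ℝ) : β (a • e) (b • (Complex.I * e)) = (a * b : ℝ) • β 1 Complex.I := by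
  have hskew : β Complex.I 1 = - β 1 Complex.I := by
    have := hβ (1 + Complex.I)
    simp only [map_add, add_apply, hβ] at this
    linear_combination this
  have e1 : e = e.re • (1 : ℂ) + e.im • Complex.I := by
    apply Complex.ext <;> simp
  have e2 : Complex.I * e = (-e.im) • (1 : ℂ) + e.re • Complex.I := by
    apply Complex.ext <;> simp
  have hn : e.re * e.re + e.im * e.im = 1 := by
    rw [← Complex.normSq_apply, Complex.normSq_eq_norm_sq, he, one_pow]
  -- A rotation has determinant one.
  have key (p q : ℝ) (hpq : p * p + q * q = 1) :
      β (p • (1 : ℂ) + q • Complex.I) ((-q) • (1 : ℂ) + p • Complex.I) = β 1 Complex.I := by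
    have hpq' : (p : ℂ) * p + q * q = 1 := by exact_mod_cast hpq
    simp only [map_add, map_smul, add_apply, smul_apply, hβ, hskew]
    simp only [Complex.real_smul, Complex.ofReal_neg]
    linear_combination hpq' * β 1 Complex.I
  have key' : β e (Complex.I * e) = β 1 Complex.I := by
    rw [e2]
    nth_rewrite 1 [e1]
    exact key _ _ hn
  rw [map_smul, map_smul, smul_apply, key', smul_smul, mul_comm b]

end Forms

section Submersion

variable {EQ : Type*} [NormedAddCommGroup EQ] [NormedSpace ℝ EQ]
  {EY : Type*} [NormedAddCommGroup EY] [NormedSpace ℝ EY]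
  {Q : Type*} [TopologicalSpace Q] [ChartedSpace EQ Q]
  {Y : Type*} [TopologicalSpace Y] [ChartedSpace EY Y]

/-- A submersion has smooth local sections. -/
lemma exists_local_section [IsManifold 𝓘(ℝ, EQ) ∞ Q] [IsManifold 𝓘(ℝ, EY) ∞ Y] {π : Y → Q} {y₀ : Y}
    (h : Manifold.IsSubmersionAt 𝓘(ℝ, EY) 𝓘(ℝ, EQ) ∞ π y₀) :
    ∃ (τ : Q → Y) (U : Set Q), IsOpen U ∧ π y₀ ∈ U ∧ ContMDiffOn 𝓘(ℝ, EQ) 𝓘(ℝ, EY) ∞ τ U ∧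
      τ (π y₀) = y₀ ∧ ∀ x ∈ U, π (τ x) = x := by
  have hdom := h.mem_domChart_source
  have hcod := h.mem_codChart_source
  have hw := h.writtenInCharts
  simp only [OpenPartialHomeomorph.extend_coe, modelWithCornersSelf_coe,
    OpenPartialHomeomorph.extend_coe_symm, modelWithCornersSelf_coe_symm,
    OpenPartialHomeomorph.extend_target, Function.id_comp, Function.comp_id, preimage_id,
    range_id, inter_univ] at hw
  -- In adapted charts the submersion is the projection to the first factor; the section freezes the
  -- second coordinate at its value for `y₀`.
  let b₀ := (h.equiv (h.domChart y₀)).2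
  let ℓ : EQ → EY := fun v => h.equiv.symm (v, b₀)
  have hℓ : ContDiff ℝ ∞ ℓ := by
    have : ContDiff ℝ ∞ (fun v : EQ => (v, b₀)) := contDiff_id.prodMk contDiff_const
    exact h.equiv.symm.contDiff.comp this
  have hval : h.codChart (π y₀) = (h.equiv (h.domChart y₀)).1 := by
    have := hw (h.domChart.map_source hdom)
    simpa [h.domChart.left_inv hdom] using this
  have hℓ₀ : ℓ (h.codChart (π y₀)) = h.domChart y₀ := by
    simp only [ℓ, b₀, hval, Prod.mk.eta, ContinuousLinearEquiv.symm_apply_apply]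
  refine ⟨fun x => h.domChart.symm (ℓ (h.codChart x)),
    h.codChart.source ∩ h.codChart ⁻¹' (ℓ ⁻¹' h.domChart.target),
    h.codChart.isOpen_inter_preimage (h.domChart.open_target.preimage hℓ.continuous),
    ⟨hcod, ?_⟩, ?_, ?_, ?_⟩
  · simp only [mem_preimage, hℓ₀]
    exact h.domChart.map_source hdom
  · have h1 := contMDiffOn_of_mem_maximalAtlas (h.codChart_mem_maximalAtlas)
    have h2 := contMDiffOn_symm_of_mem_maximalAtlas (h.domChart_mem_maximalAtlas)
    exact h2.comp (hℓ.contMDiff.comp_contMDiffOn (h1.mono inter_subset_left))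
      fun x hx => hx.2
  · simp only [hℓ₀, h.domChart.left_inv hdom]
  · rintro x ⟨hx1, hx2⟩
    have := hw hx2
    simp only [Function.comp, ℓ, ContinuousLinearEquiv.apply_symm_apply] at this
    refine h.codChart.injOn ?_ hx1 this
    exact h.source_subset_preimage_source (h.domChart.map_target hx2)

end Submersion

/-! ### Parallel isomorphisms along curves -/

section ParallelIso

universe u v u₁ v₁

variable {F : Type*} [NormedAddCommGroup F] [NormedSpace ℝ F] {H : Type*} [TopologicalSpace H]
  {I : ModelWithCorners ℝ F H} {M : Type*} [TopologicalSpace M] [ChartedSpace H M]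
  {ι κ : Type} [Fintype ι] [DecidableEq ι] [Fintype κ] [DecidableEq κ]

/-- The law `parallel` is phrased with `deriv`; smoothness of the matrix along the curve makes it a
genuine derivative. -/
lemma IsHermitianParallelIso.hasDerivAt {S : Set M} {B : BundleData.{u, v} I M ι}
    {C : BundleData.{u₁, v₁} I M κ} {φ : ∀ p, B.fiber p →ₗ[ℂ] C.fiber p}
    (hφ : IsHermitianParallelIso S B C φ) (l : B.label) (k : C.label) {W : Set ℝ} {c : ℝ → M}
    (hW : IsOpen W) (hc : ContMDiffOn 𝓘(ℝ, ℝ) I ∞ c W)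
    (hS : MapsTo c W (S ∩ B.dom l ∩ C.dom k)) {t : ℝ} (ht : t ∈ W) (a : κ) (b : ι) :
    HasDerivAt (fun s => homMatrix B C φ l k (c s) a b)
      (∑ d, homMatrix B C φ l k (c t) a d * B.conn l d b (c t) (velocity I c t) -
        ∑ d, C.conn k a d (c t) (velocity I c t) * homMatrix B C φ l k (c t) d b) t := by
  have h1 : ContMDiffOn 𝓘(ℝ, ℝ) 𝓘(ℝ, ℂ) ∞ (fun s => homMatrix B C φ l k (c s) a b) W :=
    (hφ.smooth l k a b).comp hc hS
  have h2 : DifferentiableAt ℝ (fun s => homMatrix B C φ l k (c s) a b) t :=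
    (h1.contDiffOn.contDiffAt (hW.mem_nhds ht)).differentiableAt (by simp)
  rw [hφ.parallel l k W c hW hc hS t ht a b, add_sub_cancel_right]
  exact h2.hasDerivAt

end ParallelIso

/-! ### The comparison of two descents -/

section Comparison

universe u v u₁ v₁ u₂ v₂ u₃ v₃

/-- As the dual of a line is spanned by the dual basis vector, tensors with it are recovered from a
single contraction. -/
lemma eq_contract_tmul (V : Type*) {N : Type*} [AddCommGroup V] [Module ℂ V] [AddCommGroup N]
    [Module ℂ N] (b : Module.Basis Unit ℂ N) (X : V ⊗[ℂ] Module.Dual ℂ N) :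
    X = contract V (b ()) X ⊗ₜ[ℂ] b.dualBasis () := by
  induction X with
  | zero => simp
  | add X Y hX hY => rw [map_add, TensorProduct.add_tmul, ← hX, ← hY]
  | tmul e η =>
    have : η = η (b ()) • b.dualBasis () := by
      refine b.ext fun i => ?_
      simp
    nth_rewrite 1 [this]
    rw [TensorProduct.tmul_smul, TensorProduct.smul_tmul']
    rfl

variable {EQ : Type*} [NormedAddCommGroup EQ] [NormedSpace ℝ EQ]
  {EY : Type*} [NormedAddCommGroup EY] [NormedSpace ℝ EY]
  {Q : Type*} [TopologicalSpace Q] [ChartedSpace EQ Q]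
  {Y : Type*} [TopologicalSpace Y] [ChartedSpace EY Y] [IsManifold 𝓘(ℝ, EY) ∞ Y]
  {π : Y → Q} {G : BundleGerbe.{u, v} EY π} {r : ℕ} {E : GerbeModule.{u, v, u₁, v₁} G r}
  {σ : DiskMap EQ Q}

/-- The coefficient of the isomorphism `J₁ ⊗ J₂* ≅ L` in local frames. -/
def Trivialisation.coeff (J : Trivialisation.{u, v, u₂, v₂} G σ) (l₁ l₂ : J.line.label)
    (k : G.line.label) (q : ℂ × Y × Y) : ℂ :=
  (G.line.frame k q.2).repr (J.toGerbe q (J.line.frame l₁ (q.1, q.2.1) () ⊗ₜ[ℂ]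
    (J.line.frame l₂ (q.1, q.2.2)).dualBasis ())) ()

lemma Trivialisation.homMatrix_toGerbe (J : Trivialisation.{u, v, u₂, v₂} G σ)
    (l₁ l₂ : J.line.label) (k : G.line.label) (q : ℂ × Y × Y) (i : Unit × Unit) :
    homMatrix ((J.line.pullback (diskModel₂ EY) (fun q : ℂ × Y × Y => (q.1, q.2.1))).tensor
      (J.line.pullback (diskModel₂ EY) (fun q : ℂ × Y × Y => (q.1, q.2.2))).dual)
      (G.line.pullback (diskModel₂ EY) (fun q : ℂ × Y × Y => q.2)) J.toGerbe (l₁, l₂) k q () i =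
      J.coeff l₁ l₂ k q := by
  refine (LinearMap.toMatrix_apply _ _ _ _ _).trans ?_
  have : ((J.line.pullback (diskModel₂ EY) (fun q : ℂ × Y × Y => (q.1, q.2.1))).tensor
      (J.line.pullback (diskModel₂ EY) (fun q : ℂ × Y × Y => (q.1, q.2.2))).dual).frame
      (l₁, l₂) q i = J.line.frame l₁ (q.1, q.2.1) () ⊗ₜ[ℂ]
      (J.line.frame l₂ (q.1, q.2.2)).dualBasis () :=
    Module.Basis.tensorProduct_apply' _ _ _
  rw [this]
  rfl

lemma Trivialisation.coeff_ne_zero (J : Trivialisation.{u, v, u₂, v₂} G σ) {l₁ l₂ : J.line.label}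
    {k : G.line.label} {q : ℂ × Y × Y} (hq : q ∈ diskPullbackSquare π σ)
    (h₁ : (q.1, q.2.1) ∈ J.line.dom l₁) (h₂ : (q.1, q.2.2) ∈ J.line.dom l₂)
    (hk : q.2 ∈ G.line.dom k) : J.coeff l₁ l₂ k q ≠ 0 := by
  intro h0
  have h := (J.toGerbe_iso.unitary (l₁, l₂) k q ⟨⟨hq, h₁, h₂⟩, hk⟩).2
  have h' := congrFun (congrFun h ()) ()
  rw [Matrix.mul_apply] at h'
  simp only [J.homMatrix_toGerbe, h0] at h'
  simp at h'

lemma Trivialisation.toGerbe_frame (J : Trivialisation.{u, v, u₂, v₂} G σ)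
    (l₁ l₂ : J.line.label) (k : G.line.label) (q : ℂ × Y × Y) :
    J.toGerbe q (J.line.frame l₁ (q.1, q.2.1) () ⊗ₜ[ℂ]
      (J.line.frame l₂ (q.1, q.2.2)).dualBasis ()) =
      J.coeff l₁ l₂ k q • G.line.frame k q.2 () := by
  have := (G.line.frame k q.2).sum_repr (J.toGerbe q (J.line.frame l₁ (q.1, q.2.1) () ⊗ₜ[ℂ]
      (J.line.frame l₂ (q.1, q.2.2)).dualBasis ()))
  rw [Fintype.sum_unique] at this
  exact this.symm

/-- The dual contributes the minus sign of the second `J`-term. The `L`-term does not involve `J`,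
so it will drop out of the quotient for two trivialisations. -/
lemma Trivialisation.hasDerivAt_coeff (J : Trivialisation.{u, v, u₂, v₂} G σ)
    (l₁ l₂ : J.line.label) (k : G.line.label) {W : Set ℝ} (hW : IsOpen W) {x : ℝ → ℂ}
    {y₁ y₂ : ℝ → Y}
    (hc : ContMDiffOn 𝓘(ℝ, ℝ) (diskModel₂ EY) ∞ (fun s => (x s, y₁ s, y₂ s)) W)
    (hS : ∀ s ∈ W, (x s, y₁ s, y₂ s) ∈ diskPullbackSquare π σ ∧ (x s, y₁ s) ∈ J.line.dom l₁ ∧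
      (x s, y₂ s) ∈ J.line.dom l₂ ∧ (y₁ s, y₂ s) ∈ G.line.dom k) {t : ℝ} (ht : t ∈ W) :
    HasDerivAt (fun s => J.coeff l₁ l₂ k (x s, y₁ s, y₂ s))
      ((J.line.conn l₁ () () (x t, y₁ t) (velocity (diskModel EY) (fun s => (x s, y₁ s)) t) -
        J.line.conn l₂ () () (x t, y₂ t) (velocity (diskModel EY) (fun s => (x s, y₂ s)) t) -
        G.line.conn k () () (y₁ t, y₂ t) (velocity (model₂ EY) (fun s => (y₁ s, y₂ s)) t)) *
        J.coeff l₁ l₂ k (x t, y₁ t, y₂ t)) t := by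
  have h := J.toGerbe_iso.hasDerivAt (l₁, l₂) k hW hc
    (fun s hs => ⟨⟨(hS s hs).1, (hS s hs).2.1, (hS s hs).2.2.1⟩, (hS s hs).2.2.2⟩) ht () ((), ())
  simp only [J.homMatrix_toGerbe] at h
  refine h.congr_deriv ?_
  have hcd : MDifferentiableAt 𝓘(ℝ, ℝ) (diskModel₂ EY) (fun s => (x s, y₁ s, y₂ s)) t :=
    ((hc t ht).contMDiffAt (hW.mem_nhds ht)).mdifferentiableAt (by simp)
  have e1 := mfderiv_velocity (I' := diskModel EY) (f := fun q : ℂ × Y × Y => (q.1, q.2.1))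
    (c := fun s => (x s, y₁ s, y₂ s))
    (mdifferentiableAt_fst.prodMk (mdifferentiableAt_fst.comp _ mdifferentiableAt_snd)) hcd
  have e2 := mfderiv_velocity (I' := diskModel EY) (f := fun q : ℂ × Y × Y => (q.1, q.2.2))
    (c := fun s => (x s, y₁ s, y₂ s))
    (mdifferentiableAt_fst.prodMk (mdifferentiableAt_snd.comp _ mdifferentiableAt_snd)) hcd
  have e3 := mfderiv_velocity (I' := model₂ EY) (f := fun q : ℂ × Y × Y => q.2)
    (c := fun s => (x s, y₁ s, y₂ s)) mdifferentiableAt_snd hcd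
  rw [← e1, ← e2, ← e3]
  simp only [Fintype.sum_prod_type, Finset.univ_unique, Finset.sum_singleton,
    BundleData.tensor, BundleData.dual, BundleData.pullback, if_true]
  change J.coeff l₁ l₂ k (x t, y₁ t, y₂ t) * (_ + -_) - _ * _ = _
  ring_nf
  rfl

/-- The isomorphism of `E_J` with `E`, over the domain of a local frame of `J`. -/
def Descent.eval {J : Trivialisation.{u, v, u₂, v₂} G σ}
    (EJ : Descent.{u, v, u₁, v₁, u₂, v₂, u₃, v₃} E J)
    (l : J.line.label) (q : ℂ × Y) : EJ.bundle.fiber q.1 →ₗ[ℂ] E.bundle.fiber q.2 :=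
  contract (E.bundle.fiber q.2) (J.line.frame l q ()) ∘ₗ EJ.toTensor q

/-- The matrix of `Descent.eval` in local frames. -/
def Descent.evalMatrix {J : Trivialisation.{u, v, u₂, v₂} G σ}
    (EJ : Descent.{u, v, u₁, v₁, u₂, v₂, u₃, v₃} E J) (b : EJ.bundle.label) (e : E.bundle.label)
    (l : J.line.label) (q : ℂ × Y) : Matrix (Fin r) (Fin r) ℂ :=
  LinearMap.toMatrix (EJ.bundle.frame b q.1) (E.bundle.frame e q.2) (EJ.eval l q)

section

variable {J : Trivialisation.{u, v, u₂, v₂} G σ} (EJ : Descent.{u, v, u₁, v₁, u₂, v₂, u₃, v₃} E J)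

lemma Descent.homMatrix_toTensor (b : EJ.bundle.label) (e : E.bundle.label)
    (l : J.line.label) (q : ℂ × Y) (i : Fin r × Unit) (j : Fin r) :
    homMatrix (EJ.bundle.pullback (diskModel EY) (Prod.fst : ℂ × Y → ℂ))
      ((E.bundle.pullback (diskModel EY) (Prod.snd : ℂ × Y → Y)).tensor J.line.dual) EJ.toTensor
      b (e, l) q i j = EJ.evalMatrix b e l q i.1 j := by
  refine (LinearMap.toMatrix_apply _ _ _ _ _).trans
    (Eq.trans ?_ (LinearMap.toMatrix_apply _ _ _ _ _).symm)
  change ((E.bundle.frame e q.2).tensorProduct (J.line.frame l q).dualBasis).repr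
    (EJ.toTensor q (EJ.bundle.frame b q.1 j)) i = _
  rw [eq_contract_tmul _ (J.line.frame l q) (EJ.toTensor q (EJ.bundle.frame b q.1 j))]
  rw [Module.Basis.tensorProduct_repr_tmul_apply]
  simp [Descent.eval]

lemma Descent.evalMatrix_unitary {b : EJ.bundle.label} {e : E.bundle.label} {l : J.line.label}
    {q : ℂ × Y} (hq : q ∈ diskPullback π σ) (hb : q.1 ∈ EJ.bundle.dom b)
    (he : q.2 ∈ E.bundle.dom e) (hl : q ∈ J.line.dom l) :
    (EJ.evalMatrix b e l q).conjTranspose * EJ.evalMatrix b e l q = 1 := by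
  have h := (EJ.toTensor_iso.unitary b (e, l) q ⟨⟨hq, hb⟩, he, hl⟩).1
  rw [← h]
  ext i j
  simp only [Matrix.mul_apply, Matrix.conjTranspose_apply, EJ.homMatrix_toTensor,
    Fintype.sum_prod_type, Finset.univ_unique, Finset.sum_singleton]

/-- This is `∇`-compatibility of `E_J ≅ E ⊗ J*` read in a frame of `J`; the term of `J` is scalar,
and its sign is that of the dual connection. -/
lemma Descent.hasDerivAt_evalMatrix (b : EJ.bundle.label) (e : E.bundle.label)
    (l : J.line.label) {W : Set ℝ} (hW : IsOpen W) {x : ℝ → ℂ} {y : ℝ → Y}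
    (hc : ContMDiffOn 𝓘(ℝ, ℝ) (diskModel EY) ∞ (fun s => (x s, y s)) W)
    (hS : ∀ s ∈ W, (x s, y s) ∈ diskPullback π σ ∧ x s ∈ EJ.bundle.dom b ∧
      y s ∈ E.bundle.dom e ∧ (x s, y s) ∈ J.line.dom l) {t : ℝ} (ht : t ∈ W) (i j : Fin r) :
    HasDerivAt (fun s => EJ.evalMatrix b e l (x s, y s) i j)
      (∑ d, EJ.evalMatrix b e l (x t, y t) i d * EJ.bundle.conn b d j (x t) (velocity 𝓘(ℝ, ℂ) x t) -
        (∑ d, E.bundle.conn e i d (y t) (velocity 𝓘(ℝ, EY) y t) *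
          EJ.evalMatrix b e l (x t, y t) d j -
          J.line.conn l () () (x t, y t) (velocity (diskModel EY) (fun s => (x s, y s)) t) *
            EJ.evalMatrix b e l (x t, y t) i j)) t := by
  have h := EJ.toTensor_iso.hasDerivAt b (e, l) hW hc
    (fun s hs => ⟨⟨(hS s hs).1, (hS s hs).2.1⟩, (hS s hs).2.2.1, (hS s hs).2.2.2⟩) ht (i, ()) j
  simp only [EJ.homMatrix_toTensor] at h
  refine h.congr_deriv ?_
  have hcd : MDifferentiableAt 𝓘(ℝ, ℝ) (diskModel EY) (fun s => (x s, y s)) t :=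
    ((hc t ht).contMDiffAt (hW.mem_nhds ht)).mdifferentiableAt (by simp)
  have e1 := mfderiv_velocity (I' := 𝓘(ℝ, ℂ)) (f := (Prod.fst : ℂ × Y → ℂ))
    (c := fun s => (x s, y s)) mdifferentiableAt_fst hcd
  have e2 := mfderiv_velocity (I' := 𝓘(ℝ, EY)) (f := (Prod.snd : ℂ × Y → Y))
    (c := fun s => (x s, y s)) mdifferentiableAt_snd hcd
  dsimp only at e1 e2
  rw [← e1, ← e2]
  simp only [Fintype.sum_prod_type, Finset.univ_unique, Finset.sum_singleton,
    BundleData.tensor, BundleData.dual, BundleData.pullback, if_true]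
  congr 1
  have hterm (d : Fin r) :
      ((E.bundle.conn e i d (y t)).comp (mfderiv (diskModel EY) 𝓘(ℝ, EY) Prod.snd (x t, y t)) +
        if i = d then -J.line.conn l () () (x t, y t) else 0)
        (velocity (diskModel EY) (fun s => (x s, y s)) t) * EJ.evalMatrix b e l (x t, y t) d j =
      E.bundle.conn e i d (y t) (mfderiv (diskModel EY) 𝓘(ℝ, EY) Prod.snd (x t, y t)
        (velocity (diskModel EY) (fun s => (x s, y s)) t)) * EJ.evalMatrix b e l (x t, y t) d j -
      if i = d then J.line.conn l () () (x t, y t)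
        (velocity (diskModel EY) (fun s => (x s, y s)) t) * EJ.evalMatrix b e l (x t, y t) d j
        else 0 := by
    split_ifs with hd
    · have (A B : TangentSpace (diskModel EY) (x t, y t) →L[ℝ] ℂ) (w) (m : ℂ) :
          (A + -B) w * m = A w * m - B w * m := by
        rw [add_apply, neg_apply]
        ring
      exact this _ _ _ _
    · rw [add_zero, sub_zero]
      rfl
  refine (Finset.sum_congr rfl fun d _ => hterm d).trans ?_
  rw [Finset.sum_sub_distrib, Finset.sum_ite_eq]
  simp

lemma Descent.eval_bijective {l : J.line.label} {q : ℂ × Y} (hq : q ∈ diskPullback π σ)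
    (hl : q ∈ J.line.dom l) : Function.Bijective (EJ.eval l q) := by
  obtain ⟨b, hb⟩ := mem_iUnion.1 (EJ.isHermitianBundle.cover hq.choose)
  obtain ⟨e, he⟩ := mem_iUnion.1 (E.isHermitianBundle.cover (mem_univ q.2))
  have h := EJ.evalMatrix_unitary hq hb he hl
  have hdet : IsUnit (LinearMap.toMatrix (EJ.bundle.frame b q.1) (E.bundle.frame e q.2)
      (EJ.eval l q)).det := Matrix.isUnit_det_of_left_inverse h
  exact (LinearEquiv.ofIsUnitDet hdet).bijective

/-- Descent compatibility in frames. Up to the scalar `coeff`, moving from `y₂` to `y₁` is the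
action of a frame vector of `L`, an operator that is the same for all trivialisations. -/
lemma Descent.eval_eq (l₁ l₂ : J.line.label) (k : G.line.label) {x : ℂ} {y₁ y₂ : Y}
    (h : (x, y₁, y₂) ∈ diskPullbackSquare π σ) (a : EJ.bundle.fiber x) :
    EJ.eval l₁ (x, y₁) a = J.coeff l₁ l₂ k (x, y₁, y₂) •
      E.act (y₁, y₂) (G.line.frame k (y₁, y₂) () ⊗ₜ[ℂ] EJ.eval l₂ (x, y₂) a) := by
  obtain ⟨hx, h1, h2⟩ := h
  have h := EJ.compatible x hx y₁ y₂ h1 h2 a (J.line.frame l₁ (x, y₁) ())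
  change EJ.eval l₁ (x, y₁) a = _ at h
  rw [h, eq_contract_tmul _ (J.line.frame l₂ (x, y₂)) (EJ.toTensor (x, y₂) a)]
  change E.act (y₁, y₂) (J.toGerbe (x, y₁, y₂) (J.line.frame l₁ (x, y₁) () ⊗ₜ[ℂ]
    (J.line.frame l₂ (x, y₂)).dualBasis ()) ⊗ₜ[ℂ] EJ.eval l₂ (x, y₂) a) = _
  have := J.toGerbe_frame l₁ l₂ k (x, y₁, y₂)
  dsimp only at this
  rw [this, ← TensorProduct.smul_tmul', map_smul]

end

/-- Fibrewise isomorphisms `ρ` of two descents over the disk, and their coefficients `g` with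
respect to the isomorphisms `Descent.eval` with `E`. -/
structure Comparison {J : Trivialisation.{u, v, u₂, v₂} G σ}
    {J' : Trivialisation.{u, v, u₂, v₂} G σ} (EJ : Descent.{u, v, u₁, v₁, u₂, v₂, u₃, v₃} E J)
    (EJ' : Descent.{u, v, u₁, v₁, u₂, v₂, u₃, v₃} E J') where
  /-- the isomorphisms -/
  ρ : ∀ x, EJ'.bundle.fiber x →ₗ[ℂ] EJ.bundle.fiber x
  bijective : ∀ x ∈ disk, Function.Bijective (ρ x)
  /-- their coefficients -/
  g : J.line.label → J'.line.label → ℂ × Y → ℂ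
  g_ne_zero : ∀ l l', ∀ q ∈ diskPullback π σ ∩ J.line.dom l ∩ J'.line.dom l', g l l' q ≠ 0
  eval_ρ : ∀ l l', ∀ q ∈ diskPullback π σ ∩ J.line.dom l ∩ J'.line.dom l', ∀ a,
    EJ.eval l q (ρ q.1 a) = g l l' q • EJ'.eval l' q a

variable {J J' : Trivialisation.{u, v, u₂, v₂} G σ}
  {EJ : Descent.{u, v, u₁, v₁, u₂, v₂, u₃, v₃} E J}
  {EJ' : Descent.{u, v, u₁, v₁, u₂, v₂, u₃, v₃} E J'}

/-- Take `ρ` to be the identification of both fibres with `E` at one point `y₀` over `x`. At any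
other `y` both evaluations change by the same operator of `L` up to nonzero scalars, so `ρ` still
intertwines them up to a scalar. -/
lemma exists_reference (EJ : Descent.{u, v, u₁, v₁, u₂, v₂, u₃, v₃} E J)
    (EJ' : Descent.{u, v, u₁, v₁, u₂, v₂, u₃, v₃} E J')
    (hπ : Function.Surjective π) {x : ℂ} (hx : x ∈ disk) :
    ∃ ρ : EJ'.bundle.fiber x →ₗ[ℂ] EJ.bundle.fiber x, Function.Bijective ρ ∧
      ∀ l l' y, (x, y) ∈ diskPullback π σ ∩ J.line.dom l ∩ J'.line.dom l' →
        ∃ g : ℂ, g ≠ 0 ∧ ∀ a, EJ.eval l (x, y) (ρ a) = g • EJ'.eval l' (x, y) a := by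
  obtain ⟨y₀, hy₀⟩ := hπ (σ.1 ⟨x, hx⟩)
  have hq₀ : (x, y₀) ∈ diskPullback π σ := ⟨hx, hy₀⟩
  obtain ⟨l₀, hl₀⟩ := mem_iUnion.1 (J.isHermitianBundle.cover hq₀)
  obtain ⟨l₀', hl₀'⟩ := mem_iUnion.1 (J'.isHermitianBundle.cover hq₀)
  let e := LinearEquiv.ofBijective (EJ.eval l₀ (x, y₀)) (EJ.eval_bijective hq₀ hl₀)
  let e' := LinearEquiv.ofBijective (EJ'.eval l₀' (x, y₀)) (EJ'.eval_bijective hq₀ hl₀')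
  have he (a) : EJ.eval l₀ (x, y₀) ((e' ≪≫ₗ e.symm) a) = EJ'.eval l₀' (x, y₀) a :=
    e.apply_symm_apply (e' a)
  refine ⟨(e' ≪≫ₗ e.symm).toLinearMap, (e' ≪≫ₗ e.symm).bijective, fun l l' y hy => ?_⟩
  have hsq : (x, y, y₀) ∈ diskPullbackSquare π σ := ⟨hx, hy.1.1.2, hy₀⟩
  obtain ⟨k, hk⟩ := mem_iUnion.1 (G.isHermitianBundle.cover
    (show (y, y₀) ∈ fiberSquare π from hy.1.1.2.trans hy₀.symm))
  have h1 := J.coeff_ne_zero hsq hy.1.2 hl₀ hk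
  have h2 := J'.coeff_ne_zero hsq hy.2 hl₀' hk
  refine ⟨J.coeff l l₀ k (x, y, y₀) / J'.coeff l' l₀' k (x, y, y₀), div_ne_zero h1 h2,
    fun a => ?_⟩
  rw [EJ.eval_eq l l₀ k hsq, EJ'.eval_eq l' l₀' k hsq, LinearEquiv.coe_coe, he, smul_smul,
    div_mul_cancel₀ _ h2]

lemma exists_comparison (EJ : Descent.{u, v, u₁, v₁, u₂, v₂, u₃, v₃} E J)
    (EJ' : Descent.{u, v, u₁, v₁, u₂, v₂, u₃, v₃} E J')
    (hπ : Function.Surjective π) : Nonempty (Comparison EJ EJ') := by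
  classical
  have h (x : ℂ) : ∃ ρ : EJ'.bundle.fiber x →ₗ[ℂ] EJ.bundle.fiber x, x ∈ disk →
      Function.Bijective ρ ∧
      ∀ l l' y, (x, y) ∈ diskPullback π σ ∩ J.line.dom l ∩ J'.line.dom l' →
        ∃ g : ℂ, g ≠ 0 ∧ ∀ a, EJ.eval l (x, y) (ρ a) = g • EJ'.eval l' (x, y) a := by
    by_cases hx : x ∈ disk
    · obtain ⟨ρ, hρ⟩ := exists_reference EJ EJ' hπ hx
      exact ⟨ρ, fun _ => hρ⟩
    · exact ⟨0, fun h => absurd h hx⟩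
  choose ρ hρ using h
  have h' (l : J.line.label) (l' : J'.line.label) (q : ℂ × Y) : ∃ g : ℂ,
      q ∈ diskPullback π σ ∩ J.line.dom l ∩ J'.line.dom l' →
      g ≠ 0 ∧ ∀ a, EJ.eval l q (ρ q.1 a) = g • EJ'.eval l' q a := by
    by_cases hq : q ∈ diskPullback π σ ∩ J.line.dom l ∩ J'.line.dom l'
    · obtain ⟨g, hg⟩ := (hρ q.1 hq.1.1.choose).2 l l' q.2 hq
      exact ⟨g, fun _ => hg⟩
    · exact ⟨0, fun h => absurd h hq⟩
  choose g hg using h'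
  exact ⟨⟨ρ, fun x hx => (hρ x hx).1, g, fun l l' q hq => (hg l l' q hq).1,
    fun l l' q hq => (hg l l' q hq).2⟩⟩

/-- `y` is a smooth lift of the curve `x` near `t`, in the domains of the frames `l` and `l'`. -/
def IsLiftAt (J J' : Trivialisation.{u, v, u₂, v₂} G σ) (l : J.line.label) (l' : J'.line.label)
    (x : ℝ → ℂ) (y : ℝ → Y) (t : ℝ) : Prop :=
  ∃ W, IsOpen W ∧ t ∈ W ∧
    ContMDiffOn 𝓘(ℝ, ℝ) (diskModel EY) ∞ (fun s => (x s, y s)) W ∧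
    ∀ s ∈ W, (x s, y s) ∈ diskPullback π σ ∩ J.line.dom l ∩ J'.line.dom l'

/-- The difference of the connection forms of `J'` and `J` along the curve `(x, y)`. -/
def connDiff (J J' : Trivialisation.{u, v, u₂, v₂} G σ) (l : J.line.label) (l' : J'.line.label)
    (x : ℝ → ℂ) (y : ℝ → Y) (t : ℝ) : ℂ :=
  J'.line.conn l' () () (x t, y t) (velocity (diskModel EY) (fun s => (x s, y s)) t) -
    J.line.conn l () () (x t, y t) (velocity (diskModel EY) (fun s => (x s, y s)) t)

/-- Evaluating on a frame vector, which exists since the rank is positive, gives two multiples of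
the same nonzero vector of `E`; comparing the scalars yields the ratio. The arbitrary choice of `ρ
x` cancels in it. -/
lemma Comparison.g_div (C : Comparison EJ EJ') (hr : 0 < r) {l₁ l₂ : J.line.label}
    {l₁' l₂' : J'.line.label} {k : G.line.label} {x : ℂ} {y₁ y₂ : Y}
    (h₁ : (x, y₁) ∈ diskPullback π σ ∩ J.line.dom l₁ ∩ J'.line.dom l₁')
    (h₂ : (x, y₂) ∈ diskPullback π σ ∩ J.line.dom l₂ ∩ J'.line.dom l₂')
    (hk : (y₁, y₂) ∈ G.line.dom k) :
    C.g l₁ l₁' (x, y₁) / C.g l₂ l₂' (x, y₂) =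
      J.coeff l₁ l₂ k (x, y₁, y₂) / J'.coeff l₁' l₂' k (x, y₁, y₂) := by
  have hx : x ∈ disk := h₁.1.1.choose
  have hsq : (x, y₁, y₂) ∈ diskPullbackSquare π σ := ⟨hx, h₁.1.1.2, h₂.1.1.2⟩
  obtain ⟨b, hb⟩ := mem_iUnion.1 (EJ'.isHermitianBundle.cover hx)
  let a := EJ'.bundle.frame b x ⟨0, hr⟩
  have ha : EJ'.eval l₁' (x, y₁) a ≠ 0 := fun h0 =>
    (EJ'.bundle.frame b x).ne_zero ⟨0, hr⟩
      ((EJ'.eval_bijective h₁.1.1 h₁.2).1 (h0.trans (map_zero _).symm))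
  have e := C.eval_ρ l₁ l₁' (x, y₁) h₁ a
  have e2 := C.eval_ρ l₂ l₂' (x, y₂) h₂ a
  dsimp only at e e2
  rw [EJ.eval_eq l₁ l₂ k hsq, e2, EJ'.eval_eq l₁' l₂' k hsq, TensorProduct.tmul_smul, map_smul,
    smul_smul, smul_smul] at e
  rw [EJ'.eval_eq l₁' l₂' k hsq] at ha
  have e3 := smul_left_injective ℂ (smul_ne_zero_iff.1 ha).2 e
  have n1 := C.g_ne_zero l₂ l₂' _ h₂
  have n2 := J'.coeff_ne_zero hsq h₁.2 h₂.2 hk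
  rw [div_eq_div_iff n1 n2]
  exact e3.symm

/-- Although `g` itself need not be continuous, this ratio is a quotient of the smooth coefficients
of `J` and `J'`, in which the connection form of `L` cancels. It serves as the transition rule
between lifts. -/
lemma Comparison.hasDerivAt_g_div (C : Comparison EJ EJ') (hr : 0 < r) {l₁ l₂ : J.line.label}
    {l₁' l₂' : J'.line.label} {x : ℝ → ℂ} {y₁ y₂ : ℝ → Y} {t : ℝ}
    (h₁ : IsLiftAt J J' l₁ l₁' x y₁ t) (h₂ : IsLiftAt J J' l₂ l₂' x y₂ t) :
    HasDerivAt (fun s => C.g l₁ l₁' (x s, y₁ s) / C.g l₂ l₂' (x s, y₂ s))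
      ((connDiff J J' l₂ l₂' x y₂ t - connDiff J J' l₁ l₁' x y₁ t) *
        (C.g l₁ l₁' (x t, y₁ t) / C.g l₂ l₂' (x t, y₂ t))) t := by
  obtain ⟨W₁, hW₁, ht₁, hc₁, hS₁⟩ := h₁
  obtain ⟨W₂, hW₂, ht₂, hc₂, hS₂⟩ := h₂
  obtain ⟨k, hk⟩ := mem_iUnion.1 (G.isHermitianBundle.cover
    (show (y₁ t, y₂ t) ∈ fiberSquare π from
      (hS₁ t ht₁).1.1.2.trans (hS₂ t ht₂).1.1.2.symm))
  have hy₁ : ContMDiffOn 𝓘(ℝ, ℝ) 𝓘(ℝ, EY) ∞ y₁ W₁ := contMDiff_snd.comp_contMDiffOn hc₁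
  have hy₂ : ContMDiffOn 𝓘(ℝ, ℝ) 𝓘(ℝ, EY) ∞ y₂ W₂ := contMDiff_snd.comp_contMDiffOn hc₂
  have hx : ContMDiffOn 𝓘(ℝ, ℝ) 𝓘(ℝ, ℂ) ∞ x W₁ := contMDiff_fst.comp_contMDiffOn hc₁
  have hyy : ContMDiffOn 𝓘(ℝ, ℝ) (model₂ EY) ∞ (fun s => (y₁ s, y₂ s)) (W₁ ∩ W₂) :=
    (hy₁.mono inter_subset_left).prodMk (hy₂.mono inter_subset_right)
  have hWo : IsOpen ((W₁ ∩ W₂) ∩ (fun s => (y₁ s, y₂ s)) ⁻¹' G.line.dom k) :=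
    hyy.continuousOn.isOpen_inter_preimage (hW₁.inter hW₂) (G.isHermitianBundle.isOpen_dom k)
  set W := (W₁ ∩ W₂) ∩ (fun s => (y₁ s, y₂ s)) ⁻¹' G.line.dom k
  have htW : t ∈ W := ⟨⟨ht₁, ht₂⟩, hk⟩
  have hc : ContMDiffOn 𝓘(ℝ, ℝ) (diskModel₂ EY) ∞ (fun s => (x s, y₁ s, y₂ s)) W :=
    (hx.mono fun s hs => hs.1.1).prodMk (hyy.mono inter_subset_left)
  have hsq : ∀ s ∈ W, (x s, y₁ s, y₂ s) ∈ diskPullbackSquare π σ := fun s hs =>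
    ⟨(hS₁ s hs.1.1).1.1.choose, (hS₁ s hs.1.1).1.1.2, (hS₂ s hs.1.2).1.1.2⟩
  have d := J.hasDerivAt_coeff l₁ l₂ k hWo hc (fun s hs => ⟨hsq s hs, (hS₁ s hs.1.1).1.2,
    (hS₂ s hs.1.2).1.2, hs.2⟩) htW
  have d' := J'.hasDerivAt_coeff l₁' l₂' k hWo hc (fun s hs => ⟨hsq s hs, (hS₁ s hs.1.1).2,
    (hS₂ s hs.1.2).2, hs.2⟩) htW
  have hg : ∀ s ∈ W, C.g l₁ l₁' (x s, y₁ s) / C.g l₂ l₂' (x s, y₂ s) =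
      J.coeff l₁ l₂ k (x s, y₁ s, y₂ s) / J'.coeff l₁' l₂' k (x s, y₁ s, y₂ s) := fun s hs =>
    C.g_div hr (hS₁ s hs.1.1) (hS₂ s hs.1.2) hs.2
  have n' := J'.coeff_ne_zero (hsq t htW) (hS₁ t ht₁).2 (hS₂ t ht₂).2 hk
  refine ((d.div d' n').congr_of_eventuallyEq ?_).congr_deriv ?_
  · filter_upwards [hWo.mem_nhds htW] with s hs using hg s hs
  · rw [hg t htW]
    unfold connDiff
    field_simp
    ring

end Comparison

/-! ### Flat sections of the comparison line over the plane -/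

section Flat

universe u v u₁ v₁ u₂ v₂ u₃ v₃

variable {EQ : Type*} [NormedAddCommGroup EQ] [NormedSpace ℝ EQ]
  {EY : Type*} [NormedAddCommGroup EY] [NormedSpace ℝ EY]
  {Q : Type*} [TopologicalSpace Q] [ChartedSpace EQ Q]
  {Y : Type*} [TopologicalSpace Y] [ChartedSpace EY Y] [IsManifold 𝓘(ℝ, EY) ∞ Y]
  {π : Y → Q} {G : BundleGerbe.{u, v} EY π} {r : ℕ} {E : GerbeModule.{u, v, u₁, v₁} G r}
  {σ : DiskMap EQ Q} {J J' : Trivialisation.{u, v, u₂, v₂} G σ}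
  {EJ : Descent.{u, v, u₁, v₁, u₂, v₂, u₃, v₃} E J}
  {EJ' : Descent.{u, v, u₁, v₁, u₂, v₂, u₃, v₃} E J'}

/-- Compose a local section of `π` with the disk map. The disk map is smooth only along the disk,
but `x` stays there, so the composite is smooth on an open set even where `x` touches the boundary.
-/
lemma exists_lift [IsManifold 𝓘(ℝ, EQ) ∞ Q] (hπ : Manifold.IsSubmersion 𝓘(ℝ, EY) 𝓘(ℝ, EQ) ∞ π)
    (hs : Function.Surjective π) (J J' : Trivialisation.{u, v, u₂, v₂} G σ)
    {V : Type*} [NormedAddCommGroup V] [NormedSpace ℝ V] {x : V → ℂ} (hx : ContDiff ℝ ∞ x)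
    (hd : ∀ w, x w ∈ disk) (w₀ : V) :
    ∃ (y : V → Y) (l : J.line.label) (l' : J'.line.label) (W : Set V), IsOpen W ∧ w₀ ∈ W ∧
      ContMDiffOn 𝓘(ℝ, V) (diskModel EY) ∞ (fun w => (x w, y w)) W ∧
      ∀ w ∈ W, (x w, y w) ∈ diskPullback π σ ∩ J.line.dom l ∩ J'.line.dom l' := by
  obtain ⟨f, hf, hfσ⟩ := σ.2
  obtain ⟨y₀, hy₀⟩ := hs (f (x w₀))
  obtain ⟨τ, U, hU, hyU, hτ, hτ₀, hτπ⟩ := exists_local_section (hπ.isSubmersionAt y₀)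
  have hfx : ContMDiff 𝓘(ℝ, V) 𝓘(ℝ, EQ) ∞ (fun w => f (x w)) := fun w =>
    contMDiffWithinAt_univ.1
      (hf.comp (s := univ) hx.contMDiff.contMDiffOn (fun w _ => hd w) w (mem_univ w))
  have hW₀ : IsOpen ((fun w => f (x w)) ⁻¹' U) := hU.preimage hfx.continuous
  have hγ : ContMDiffOn 𝓘(ℝ, V) (diskModel EY) ∞ (fun w => (x w, τ (f (x w))))
      ((fun w => f (x w)) ⁻¹' U) :=
    hx.contMDiff.contMDiffOn.prodMk (hτ.comp hfx.contMDiffOn fun w hw => hw)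
  have hlift : ∀ w ∈ (fun w => f (x w)) ⁻¹' U, (x w, τ (f (x w))) ∈ diskPullback π σ :=
    fun w hw => ⟨hd w, (hτπ _ hw).trans (hfσ ⟨x w, hd w⟩)⟩
  have hw₀ : w₀ ∈ (fun w => f (x w)) ⁻¹' U := by
    simp only [mem_preimage, ← hy₀]
    exact hyU
  obtain ⟨l, hl⟩ := mem_iUnion.1 (J.isHermitianBundle.cover (hlift w₀ hw₀))
  obtain ⟨l', hl'⟩ := mem_iUnion.1 (J'.isHermitianBundle.cover (hlift w₀ hw₀))
  refine ⟨fun w => τ (f (x w)), l, l', _ ∩ (fun w => (x w, τ (f (x w)))) ⁻¹'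
    (J.line.dom l ∩ J'.line.dom l'), hγ.continuousOn.isOpen_inter_preimage hW₀
      ((J.isHermitianBundle.isOpen_dom l).inter (J'.isHermitianBundle.isOpen_dom l')),
      ⟨hw₀, hl, hl'⟩, hγ.mono inter_subset_left, fun w hw => ⟨⟨hlift w hw.1, hw.2.1⟩, hw.2.2⟩⟩

/-- The section of the comparison line with coefficient `u` along the curve `x` has logarithmic
covariant derivative `b` at time `t`. -/
def Comparison.HasLogDeriv (C : Comparison EJ EJ') (x : ℝ → ℂ) (u : ℝ → ℂ) (b : ℂ) (t : ℝ) :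
    Prop :=
  ∀ l l' y, IsLiftAt J J' l l' x y t → HasDerivAt (fun s => u s * C.g l l' (x s, y s))
    ((b - connDiff J J' l l' x y t) * (u t * C.g l l' (x t, y t))) t

lemma IsLiftAt.eventually_g_ne_zero {l : J.line.label} {l' : J'.line.label} {x : ℝ → ℂ}
    {y : ℝ → Y} {t : ℝ} (h : IsLiftAt J J' l l' x y t) (C : Comparison EJ EJ') :
    ∀ᶠ s in 𝓝 t, C.g l l' (x s, y s) ≠ 0 := by
  obtain ⟨W, hW, ht, -, hS⟩ := h
  filter_upwards [hW.mem_nhds ht] with s hs using C.g_ne_zero l l' _ (hS s hs)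

/-- One lift suffices: multiplication by the transition ratio replaces its connection difference by
that of any other lift. -/
lemma Comparison.hasLogDeriv_of_lift (C : Comparison EJ EJ') (hr : 0 < r) {x u : ℝ → ℂ} {b : ℂ}
    {t : ℝ} {l : J.line.label} {l' : J'.line.label} {y : ℝ → Y} (h : IsLiftAt J J' l l' x y t)
    (hd : HasDerivAt (fun s => u s * C.g l l' (x s, y s))
      ((b - connDiff J J' l l' x y t) * (u t * C.g l l' (x t, y t))) t) :
    C.HasLogDeriv x u b t := by
  intro l₁ l₁' y₁ h₁
  have hd' := hd.mul (C.hasDerivAt_g_div hr h₁ h)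
  have hn := (h.eventually_g_ne_zero C).self_of_nhds
  refine (hd'.congr_of_eventuallyEq ?_).congr_deriv ?_
  · filter_upwards [h.eventually_g_ne_zero C] with s hs
    simp only [Pi.mul_apply]
    field_simp
  · field_simp
    ring

lemma Comparison.HasLogDeriv.congr {C : Comparison EJ EJ'} {x u w : ℝ → ℂ} {b : ℂ} {t : ℝ}
    (h : C.HasLogDeriv x u b t) (huw : w =ᶠ[𝓝 t] u) : C.HasLogDeriv x w b t := by
  intro l l' y hy
  rw [huw.self_of_nhds]
  refine (h l l' y hy).congr_of_eventuallyEq ?_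
  filter_upwards [huw] with s hs
  rw [hs]

lemma Comparison.HasLogDeriv.mul {C : Comparison EJ EJ'} {x u w : ℝ → ℂ} {b c : ℂ} {t : ℝ}
    (h : C.HasLogDeriv x u b t) (hw : HasDerivAt w (c * w t) t) :
    C.HasLogDeriv x (fun s => w s * u s) (b + c) t := by
  intro l l' y hy
  refine ((hw.mul (h l l' y hy)).congr_of_eventuallyEq ?_).congr_deriv ?_
  · exact Eventually.of_forall fun s => mul_assoc _ _ _
  · ring

/-- Equal logarithmic covariant derivatives cancel in the quotient, and so does the unknown factor
`g`. -/
lemma Comparison.HasLogDeriv.div {C : Comparison EJ EJ'} {x u w : ℝ → ℂ} {b : ℂ} {t : ℝ}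
    (hu : C.HasLogDeriv x u b t) (hw : C.HasLogDeriv x w b t) (hw₀ : w t ≠ 0)
    {l : J.line.label} {l' : J'.line.label} {y : ℝ → Y} (h : IsLiftAt J J' l l' x y t) :
    HasDerivAt (fun s => u s / w s) 0 t := by
  have hn := (h.eventually_g_ne_zero C).self_of_nhds
  refine (((hu l l' y h).div (hw l l' y h) (mul_ne_zero hw₀ hn)).congr_of_eventuallyEq
    ?_).congr_deriv ?_
  · filter_upwards [h.eventually_g_ne_zero C] with s hs
    exact (mul_div_mul_right _ _ hs).symm
  · ring

/-- `u` is, at the point `z` of the plane, the coefficient of a section of the comparison line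
(pulled back along `P`) with covariant derivative `a dt`. -/
def Comparison.IsFlatAt (C : Comparison EJ EJ') (P a u : ℝ × ℝ → ℂ) (z : ℝ × ℝ) : Prop :=
  u z ≠ 0 ∧ C.HasLogDeriv (fun s => P (s, z.2)) (fun s => u (s, z.2)) 0 z.1 ∧
    C.HasLogDeriv (fun t => P (z.1, t)) (fun t => u (z.1, t)) (a z) z.2

lemma isLiftAt_of_exists_lift [IsManifold 𝓘(ℝ, EQ) ∞ Q]
    (hπ : Manifold.IsSubmersion 𝓘(ℝ, EY) 𝓘(ℝ, EQ) ∞ π)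
    (hs : Function.Surjective π) (J J' : Trivialisation.{u, v, u₂, v₂} G σ) {x : ℝ → ℂ}
    (hx : ContDiff ℝ ∞ x) (hd : ∀ w, x w ∈ disk) (t : ℝ) :
    ∃ l l' y, IsLiftAt J J' l l' x y t := by
  obtain ⟨y, l, l', W, h⟩ := exists_lift hπ hs J J' hx hd t
  exact ⟨l, l', y, W, h⟩

variable [IsManifold 𝓘(ℝ, EQ) ∞ Q] (hπ : Manifold.IsSubmersion 𝓘(ℝ, EY) 𝓘(ℝ, EQ) ∞ π)
  (hs : Function.Surjective π)

include hπ hs in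
lemma Comparison.IsFlatAt.div_eq_div {C : Comparison EJ EJ'} {P a : ℝ × ℝ → ℂ}
    (hP : ContDiff ℝ ∞ P) (hd : ∀ z, P z ∈ disk) {u w : ℝ × ℝ → ℂ} {a₁ b₁ a₂ b₂ : ℝ}
    (hu : ∀ z ∈ Ioo a₁ b₁ ×ˢ Ioo a₂ b₂, C.IsFlatAt P a u z)
    (hw : ∀ z ∈ Ioo a₁ b₁ ×ˢ Ioo a₂ b₂, C.IsFlatAt P a w z) :
    ∀ z ∈ Ioo a₁ b₁ ×ˢ Ioo a₂ b₂, ∀ z' ∈ Ioo a₁ b₁ ×ˢ Ioo a₂ b₂, u z / w z = u z' / w z' := by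
  intro z hz z' hz'
  refine eq_of_partial_zero_box (f := fun z => u z / w z) ?_ ?_ hz hz'
  · intro z hz
    obtain ⟨l, l', y, h⟩ := isLiftAt_of_exists_lift hπ hs J J' (x := fun s => P (s, z.2))
      (hP.comp (contDiff_id.prodMk contDiff_const)) (fun s => hd _) z.1
    exact (hu z hz).2.1.div (hw z hz).2.1 (hw z hz).1 h
  · intro z hz
    obtain ⟨l, l', y, h⟩ := isLiftAt_of_exists_lift hπ hs J J' (x := fun t => P (z.1, t))
      (hP.comp (contDiff_const.prodMk contDiff_id)) (fun s => hd _) z.2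
    exact (hu z hz).2.2.div (hw z hz).2.2 (hw z hz).1 h

/-- The coefficient of the pull-back of the difference of two 2-forms. -/
def pullbackDiff (P : ℝ × ℝ → ℂ) (μ μ' : TwoTensor 𝓘(ℝ, ℂ) ℂ) (z : ℝ × ℝ) : ℂ :=
  μ (P z) (mfderiv 𝓘(ℝ, ℝ × ℝ) 𝓘(ℝ, ℂ) P z ((1, 0) : ℝ × ℝ))
    (mfderiv 𝓘(ℝ, ℝ × ℝ) 𝓘(ℝ, ℂ) P z ((0, 1) : ℝ × ℝ)) -
  μ' (P z) (mfderiv 𝓘(ℝ, ℝ × ℝ) 𝓘(ℝ, ℂ) P z ((1, 0) : ℝ × ℝ))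
    (mfderiv 𝓘(ℝ, ℝ × ℝ) 𝓘(ℝ, ℂ) P z ((0, 1) : ℝ × ℝ))

include hπ hs in
lemma Comparison.exists_isFlatAt_local (C : Comparison EJ EJ') (hr : 0 < r)
    {μ μ' : TwoTensor 𝓘(ℝ, ℂ) ℂ} (hμ : J.IsCurvingDefect μ) (hμ' : J'.IsCurvingDefect μ')
    {P a : ℝ × ℝ → ℂ} (hP : ContDiff ℝ ∞ P) (hd : ∀ z, P z ∈ disk) (ha : Continuous a)
    (haP : ∀ z : ℝ × ℝ, HasDerivAt (fun s => a (s, z.2)) (pullbackDiff P μ μ' z) z.1)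
    (z₀ : ℝ × ℝ) : ∃ u, ∀ᶠ z in 𝓝 z₀, C.IsFlatAt P a u z := by
  obtain ⟨y, l, l', W, hW, hz₀, hγ, hS⟩ := exists_lift hπ hs J J' hP hd z₀
  obtain ⟨δ, hδ, hball⟩ := Metric.isOpen_iff.1 hW z₀ hz₀
  have hbox : Metric.ball z₀ δ = Ioo (z₀.1 - δ) (z₀.1 + δ) ×ˢ Ioo (z₀.2 - δ) (z₀.2 + δ) := by
    rw [← Real.ball_eq_Ioo, ← Real.ball_eq_Ioo, ball_prod_same]
  rw [hbox] at hball
  set U := Ioo (z₀.1 - δ) (z₀.1 + δ) ×ˢ Ioo (z₀.2 - δ) (z₀.2 + δ) with hU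
  have hUo : IsOpen U := isOpen_Ioo.prod isOpen_Ioo
  have hz₀U : z₀ ∈ U := hbox ▸ Metric.mem_ball_self hδ
  replace hγ := hγ.mono hball
  have hS' : ∀ w ∈ U, (P w, y w) ∈ diskPullback π σ ∩ J.line.dom l ∩ J'.line.dom l' :=
    fun w hw => hS w (hball hw)
  have hγd : ∀ z ∈ U, MDifferentiableAt 𝓘(ℝ, ℝ × ℝ) (diskModel EY) (fun w => (P w, y w)) z :=
    fun z hz => ((hγ z hz).contMDiffAt (hUo.mem_nhds hz)).mdifferentiableAt (by simp)
  let D (v : ℝ × ℝ) (z : ℝ × ℝ) : TangentSpace (diskModel EY) (P z, y z) :=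
    mfderiv 𝓘(ℝ, ℝ × ℝ) (diskModel EY) (fun w => (P w, y w)) z v
  have hsm (v : ℝ × ℝ) : ContDiffOn ℝ ∞ (fun z => J.line.conn l () () (P z, y z) (D v z)) U :=
    (J.isHermitianBundle.smooth_conn l () ()).contDiffOn_pullback hUo hγ
      (fun z hz => ⟨(hS' z hz).1.1, (hS' z hz).1.2⟩) v
  have hsm' (v : ℝ × ℝ) : ContDiffOn ℝ ∞ (fun z => J'.line.conn l' () () (P z, y z) (D v z)) U :=
    (J'.isHermitianBundle.smooth_conn l' () ()).contDiffOn_pullback hUo hγ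
      (fun z hz => ⟨(hS' z hz).1.1, (hS' z hz).2⟩) v
  let θ (v : ℝ × ℝ) (z : ℝ × ℝ) : ℂ :=
    J'.line.conn l' () () (P z, y z) (D v z) - J.line.conn l () () (P z, y z) (D v z)
  have hθ (v : ℝ × ℝ) : ContDiffOn ℝ 1 (θ v) U :=
    ((hsm' v).sub (hsm v)).of_le (by simp)
  have hda {f : ℝ × ℝ → ℂ} (hf : ContDiffOn ℝ ∞ f U) {z : ℝ × ℝ} (hz : z ∈ U) :
      DifferentiableAt ℝ f z :=
    (hf.contDiffAt (hUo.mem_nhds hz)).differentiableAt (by simp)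
  have hcurl : ∀ z ∈ U, fderiv ℝ (θ (0, 1)) z (1, 0) - fderiv ℝ (θ (1, 0)) z (0, 1) =
      pullbackDiff P μ μ' z := by
    intro z hz
    have h1 := hμ.2 l U (fun w => (P w, y w)) hUo hγ
      (fun z hz => ⟨(hS' z hz).1.1, (hS' z hz).1.2⟩) z hz
    have h2 := hμ'.2 l' U (fun w => (P w, y w)) hUo hγ
      (fun z hz => ⟨(hS' z hz).1.1, (hS' z hz).2⟩) z hz
    have e1 : fderiv ℝ (θ (0, 1)) z (1, 0) =
        fderiv ℝ (fun z => J'.line.conn l' () () (P z, y z) (D (0, 1) z)) z (1, 0) -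
        fderiv ℝ (fun z => J.line.conn l () () (P z, y z) (D (0, 1) z)) z (1, 0) := by
      rw [← sub_apply, ← fderiv_sub (hda (hsm' _) hz) (hda (hsm _) hz)]
      rfl
    have e2 : fderiv ℝ (θ (1, 0)) z (0, 1) =
        fderiv ℝ (fun z => J'.line.conn l' () () (P z, y z) (D (1, 0) z)) z (0, 1) -
        fderiv ℝ (fun z => J.line.conn l () () (P z, y z) (D (1, 0) z)) z (0, 1) := by
      rw [← sub_apply, ← fderiv_sub (hda (hsm' _) hz) (hda (hsm _) hz)]
      rfl
    have e3 (v : ℝ × ℝ) : mfderiv (diskModel EY) 𝓘(ℝ, ℂ) Prod.fst (P z, y z) (D v z) =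
        mfderiv 𝓘(ℝ, ℝ × ℝ) 𝓘(ℝ, ℂ) P z v := by
      have := mfderiv_comp (I'' := 𝓘(ℝ, ℂ)) (g := (Prod.fst : ℂ × Y → ℂ)) z
        mdifferentiableAt_fst (hγd z hz)
      exact (DFunLike.congr_fun this v).symm
    rw [e1, e2]
    unfold curvingSub at h1 h2
    unfold pullbackDiff
    rw [← e3, ← e3]
    -- The curving `f` cancels between the two curvatures, leaving the pull-back of `μ - μ'`.
    linear_combination h2 - h1
  obtain ⟨Λ, hΛ⟩ := exists_primitive_box hz₀U (hθ (1, 0)) (hθ (0, 1)) ha haP hcurl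
  have hgne : ∀ z ∈ U, C.g l l' (P z, y z) ≠ 0 := fun z hz => C.g_ne_zero l l' _ (hS' z hz)
  -- Dividing by `g` makes the product tested in `HasLogDeriv` equal to `exp Λ`, whatever the
  -- regularity of `g`.
  refine ⟨fun z => Complex.exp (Λ z) / C.g l l' (P z, y z), ?_⟩
  filter_upwards [hUo.mem_nhds hz₀U] with z hz
  have hug : ∀ z ∈ U, Complex.exp (Λ z) / C.g l l' (P z, y z) * C.g l l' (P z, y z) =
      Complex.exp (Λ z) := fun z hz => div_mul_cancel₀ _ (hgne z hz)
  refine ⟨div_ne_zero (Complex.exp_ne_zero _) (hgne z hz), ?_, ?_⟩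
  · have hc : Continuous (fun s : ℝ => (s, z.2)) := by fun_prop
    have hWo := hUo.preimage hc
    refine C.hasLogDeriv_of_lift hr (l := l) (l' := l') (y := fun s => y (s, z.2))
      ⟨_, hWo, hz, ?_, fun s hs => hS' _ hs⟩ ?_
    · exact hγ.comp (contDiff_id.prodMk contDiff_const).contMDiff.contMDiffOn fun s hs => hs
    · refine ((hΛ z hz).1.cexp.congr_of_eventuallyEq ?_).congr_deriv ?_
      · filter_upwards [hWo.mem_nhds hz] with s hs using hug _ hs
      · rw [hug z hz]
        unfold connDiff
        rw [velocity_fst_line (γ := fun w => (P w, y w)) (hγd z hz), zero_sub, mul_comm]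
  · have hc : Continuous (fun t : ℝ => (z.1, t)) := by fun_prop
    have hWo := hUo.preimage hc
    refine C.hasLogDeriv_of_lift hr (l := l) (l' := l') (y := fun t => y (z.1, t))
      ⟨_, hWo, hz, ?_, fun s hs => hS' _ hs⟩ ?_
    · exact hγ.comp (contDiff_const.prodMk contDiff_id).contMDiff.contMDiffOn fun s hs => hs
    · refine ((hΛ z hz).2.cexp.congr_of_eventuallyEq ?_).congr_deriv ?_
      · filter_upwards [hWo.mem_nhds hz] with s hs using hug _ hs
      · rw [hug z hz]
        unfold connDiff
        rw [velocity_snd_line (γ := fun w => (P w, y w)) (hγd z hz), mul_comm]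

include hπ hs in
lemma Comparison.exists_isFlatAt (C : Comparison EJ EJ') (hr : 0 < r)
    {μ μ' : TwoTensor 𝓘(ℝ, ℂ) ℂ} (hμ : J.IsCurvingDefect μ) (hμ' : J'.IsCurvingDefect μ')
    {P a : ℝ × ℝ → ℂ} (hP : ContDiff ℝ ∞ P) (hd : ∀ z, P z ∈ disk) (ha : Continuous a)
    (haP : ∀ z : ℝ × ℝ, HasDerivAt (fun s => a (s, z.2)) (pullbackDiff P μ μ' z) z.1) :
    ∃ u, ∀ z, C.IsFlatAt P a u z := by
  refine exists_global_of_local ?_ ?_ (fun u z h => h.1)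
    (C.exists_isFlatAt_local hπ hs hr hμ hμ' hP hd ha haP)
    (fun u v a b c d hu hv => Comparison.IsFlatAt.div_eq_div hπ hs hP hd hu hv)
  · intro u w z huw h
    have c1 : Tendsto (fun s : ℝ => (s, z.2)) (𝓝 z.1) (𝓝 z) :=
      (by fun_prop : Continuous fun s : ℝ => (s, z.2)).tendsto' _ _ rfl
    have c2 : Tendsto (fun t : ℝ => (z.1, t)) (𝓝 z.2) (𝓝 z) :=
      (by fun_prop : Continuous fun t : ℝ => (z.1, t)).tendsto' _ _ rfl
    exact ⟨huw.self_of_nhds ▸ h.1, h.2.1.congr (c1.eventually huw.symm),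
      h.2.2.congr (c2.eventually huw.symm)⟩
  · intro k u z hk h
    have hz (t : ℝ) : HasDerivAt (fun _ : ℝ => k) (0 * k) t := by
      rw [zero_mul]
      exact hasDerivAt_const _ _
    refine ⟨mul_ne_zero hk h.1, ?_, ?_⟩
    · simpa using h.2.1.mul (hz z.1)
    · simpa using h.2.2.mul (hz z.2)

/-! ### Polar coordinates and the monodromy of the comparison line -/

/-- A smooth map of the plane onto the disk, in polar coordinates `(sin s, t)`. -/
def polarDisk (z : ℝ × ℝ) : ℂ := Real.sin z.1 • boundaryCircle z.2

lemma contDiff_boundaryCircle : ContDiff ℝ ∞ boundaryCircle :=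
  (Complex.ofRealCLM.contDiff.mul contDiff_const).cexp

lemma contDiff_polarDisk : ContDiff ℝ ∞ polarDisk :=
  (Real.contDiff_sin.comp contDiff_fst).smul (contDiff_boundaryCircle.comp contDiff_snd)

lemma norm_boundaryCircle (t : ℝ) : ‖boundaryCircle t‖ = 1 := Complex.norm_exp_ofReal_mul_I t

lemma polarDisk_mem (z : ℝ × ℝ) : polarDisk z ∈ disk := by
  unfold disk polarDisk
  rw [mem_closedBall_zero_iff, norm_smul, norm_boundaryCircle, mul_one]
  exact Real.abs_sin_le_one _

lemma boundaryCircle_mem (t : ℝ) : boundaryCircle t ∈ disk := by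
  unfold disk
  rw [mem_closedBall_zero_iff, norm_boundaryCircle]

lemma boundaryCircle_two_pi : boundaryCircle (2 * Real.pi) = boundaryCircle 0 := by
  unfold boundaryCircle
  push_cast
  rw [Complex.exp_two_pi_mul_I, zero_mul, Complex.exp_zero]

lemma continuous_pullbackDiff {μ μ' : TwoTensor 𝓘(ℝ, ℂ) ℂ} (hμ : IsSmoothTwoForm 𝓘(ℝ, ℂ) disk μ)
    (hμ' : IsSmoothTwoForm 𝓘(ℝ, ℂ) disk μ') : Continuous (pullbackDiff polarDisk μ μ') := by
  have h1 := hμ.contDiffOn_pullback isOpen_univ contDiff_polarDisk.contMDiff.contMDiffOn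
    (fun z _ => polarDisk_mem z) (1, 0) (0, 1)
  have h2 := hμ'.contDiffOn_pullback isOpen_univ contDiff_polarDisk.contMDiff.contMDiffOn
    (fun z _ => polarDisk_mem z) (1, 0) (0, 1)
  exact continuousOn_univ.1 (h1.continuousOn.sub h2.continuousOn)

include hπ hs in
/-- The comparison line has a parallel section along the boundary circle, whose monodromy is
given by the integral of the curvature. -/
lemma Comparison.exists_parallel (C : Comparison EJ EJ') (hr : 0 < r)
    {μ μ' : TwoTensor 𝓘(ℝ, ℂ) ℂ} (hμ : J.IsCurvingDefect μ) (hμ' : J'.IsCurvingDefect μ') :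
    ∃ w : ℝ → ℂ, (∀ t, w t ≠ 0) ∧ (∀ t, C.HasLogDeriv boundaryCircle w 0 t) ∧
      w (2 * Real.pi) = Complex.exp (-∫ t in (0 : ℝ)..(2 * Real.pi),
        ∫ s in (0 : ℝ)..(Real.pi / 2), pullbackDiff polarDisk μ μ' (s, t)) * w 0 := by
  have hω := continuous_pullbackDiff hμ.1 hμ'.1
  let a (z : ℝ × ℝ) : ℂ := ∫ s in (0 : ℝ)..z.1, pullbackDiff polarDisk μ μ' (s, z.2)
  have ha : Continuous a :=
    intervalIntegral.continuous_parametric_intervalIntegral_of_continuous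
      (f := fun z : ℝ × ℝ => fun s => pullbackDiff polarDisk μ μ' (s, z.2))
      (hω.comp (by fun_prop)) continuous_fst
  have haP : ∀ z : ℝ × ℝ, HasDerivAt (fun s => a (s, z.2)) (pullbackDiff polarDisk μ μ' z) z.1 := by
    intro z
    have hc : Continuous (fun s => pullbackDiff polarDisk μ μ' (s, z.2)) := hω.comp (by fun_prop)
    exact intervalIntegral.integral_hasDerivAt_right (hc.intervalIntegrable _ _)
      (hc.stronglyMeasurableAtFilter _ _) hc.continuousAt
  obtain ⟨u, hu⟩ := C.exists_isFlatAt hπ hs hr hμ hμ' contDiff_polarDisk polarDisk_mem ha haP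
  have h0 (t : ℝ) : polarDisk (0, t) = 0 := by simp [polarDisk]
  have hπ2 (t : ℝ) : polarDisk (Real.pi / 2, t) = boundaryCircle t := by simp [polarDisk]
  have h2π (s : ℝ) : polarDisk (s, 2 * Real.pi) = polarDisk (s, 0) := by
    simp only [polarDisk, boundaryCircle_two_pi]
  -- Over `s = 0` the curve rests at the centre: a constant lift has zero velocity, and `a` vanishes
  -- there, so the coefficient is constant.
  have hu0 : ∀ t, HasDerivAt (fun t => u (0, t)) 0 t := by
    intro t
    obtain ⟨l, l', y, hy⟩ := isLiftAt_of_exists_lift hπ hs J J' (x := fun _ => (0 : ℂ))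
      contDiff_const (fun _ => by simp [disk]) t
    obtain ⟨W, -, htW, -, hS⟩ := hy
    have hlift : IsLiftAt J J' l l' (fun _ => (0 : ℂ)) (fun _ => y t) t :=
      ⟨univ, isOpen_univ, mem_univ _, contMDiffOn_const, fun _ _ => hS t htW⟩
    have h1 := (hu (0, t)).2.2
    simp only [h0] at h1
    have h2 := h1 l l' _ hlift
    have hc : connDiff J J' l l' (fun _ => (0 : ℂ)) (fun _ => y t) t = 0 := by
      unfold connDiff
      rw [velocity_const, map_zero, map_zero, sub_zero]
    have ha0 : a (0, t) = 0 := intervalIntegral.integral_same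
    rw [hc, ha0, sub_zero, zero_mul] at h2
    have hg := C.g_ne_zero l l' _ (hS t htW)
    have h3 := h2.div_const (C.g l l' (0, y t))
    simpa [hg] using h3
  -- The rays at angles `0` and `2π` are the same curve in the disk, so both coefficients refer to
  -- the same `ρ` and may be compared.
  have hs0 : ∀ s, HasDerivAt (fun s => u (s, 2 * Real.pi) / u (s, 0)) 0 s := by
    intro s
    have h1 := (hu (s, 2 * Real.pi)).2.1
    simp only [h2π] at h1
    obtain ⟨l, l', y, hy⟩ := isLiftAt_of_exists_lift hπ hs J J' (x := fun s => polarDisk (s, 0))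
      (contDiff_polarDisk.comp (contDiff_id.prodMk contDiff_const)) (fun s => polarDisk_mem _) s
    exact h1.div (hu (s, 0)).2.1 (hu (s, 0)).1 hy
  have hper : u (Real.pi / 2, 2 * Real.pi) = u (Real.pi / 2, 0) := by
    have e1 := eq_of_hasDerivAt_zero hs0 (Real.pi / 2) 0
    have e2 := eq_of_hasDerivAt_zero hu0 (2 * Real.pi) 0
    rw [e2, div_self (hu (0, 0)).1] at e1
    exact (div_eq_one_iff_eq (hu _).1).1 e1
  have hac : Continuous (fun t => a (Real.pi / 2, t)) := ha.comp (by fun_prop)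
  refine ⟨fun t => Complex.exp (-∫ τ in (0 : ℝ)..t, a (Real.pi / 2, τ)) * u (Real.pi / 2, t),
    fun t => mul_ne_zero (Complex.exp_ne_zero _) (hu _).1, fun t => ?_, ?_⟩
  · have h1 := (hu (Real.pi / 2, t)).2.2
    simp only [hπ2] at h1
    have h2 : HasDerivAt (fun t => ∫ τ in (0 : ℝ)..t, a (Real.pi / 2, τ)) (a (Real.pi / 2, t)) t :=
      intervalIntegral.integral_hasDerivAt_right (hac.intervalIntegrable _ _)
        (hac.stronglyMeasurableAtFilter _ _) hac.continuousAt
    have h3 := h2.neg.cexp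
    rw [mul_comm] at h3
    simpa using h1.mul h3
  · simp only [intervalIntegral.integral_same, neg_zero, Complex.exp_zero, one_mul, hper, a]

end Flat

/-! ### Parallel transport -/

section Transport

universe u v u₁ v₁ u₂ v₂ u₃ v₃

open Matrix in
/-- A solution of a linear equation transforms to a solution under a gauge transformation. -/
lemma hasDerivAt_of_gauge {n : ℕ} {M M' : ℝ → Matrix (Fin n) (Fin n) ℂ} {X X' : ℝ → Fin n → ℂ}
    {k : ℝ → ℂ} {A A' N : Matrix (Fin n) (Fin n) ℂ} {α α' : ℂ} {t : ℝ}
    (hM : ∀ i j, HasDerivAt (fun s => M s i j) ((M t * A - (N * M t - α • M t)) i j) t)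
    (hM' : ∀ i j, HasDerivAt (fun s => M' s i j) ((M' t * A' - (N * M' t - α' • M' t)) i j) t)
    (hX' : ∀ i, HasDerivAt (fun s => X' s i) ((-(A' *ᵥ X' t)) i) t)
    (hk : HasDerivAt k ((0 - (α' - α)) * k t) t)
    (hu : ∀ᶠ s in 𝓝 t, (M s)ᴴ * M s = 1)
    (hrel : ∀ᶠ s in 𝓝 t, M s *ᵥ X s = k s • (M' s *ᵥ X' s)) (i : Fin n) :
    HasDerivAt (fun s => X s i) ((-(A *ᵥ X t)) i) t := by
  set Z : ℝ → Fin n → ℂ := fun s => k s • (M' s *ᵥ X' s) with hZ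
  have hmv (i : Fin n) : HasDerivAt (fun s => (M' s *ᵥ X' s) i)
      (((M' t * A' - (N * M' t - α' • M' t)) *ᵥ X' t + M' t *ᵥ (-(A' *ᵥ X' t))) i) t := by
    have := HasDerivAt.fun_sum (u := Finset.univ) fun j _ => (hM' i j).mul (hX' j)
    rw [Finset.sum_add_distrib] at this
    exact this
  have hZd (i : Fin n) : HasDerivAt (fun s => Z s i) ((α • Z t - N *ᵥ Z t) i) t := by
    refine (hk.mul (hmv i)).congr_deriv ?_
    simp only [hZ, Matrix.sub_mulVec, Matrix.mulVec_neg, Matrix.smul_mulVec, Matrix.mulVec_smul,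
      ← Matrix.mulVec_mulVec, Pi.add_apply, Pi.sub_apply, Pi.neg_apply, Pi.smul_apply, smul_eq_mul]
    ring
  have hX : ∀ᶠ s in 𝓝 t, X s = (M s)ᴴ *ᵥ Z s := by
    filter_upwards [hu, hrel] with s h1 h2
    change _ = (M s)ᴴ *ᵥ (k s • (M' s *ᵥ X' s))
    rw [← h2, Matrix.mulVec_mulVec, h1, Matrix.one_mulVec]
  -- Unitarity of `M` serves only to invert it and to see that `X` is differentiable. The connection
  -- need not be unitary, so the derivative is found by differentiating `M X = Z` and cancelling `M
  -- t`.
  have hXd : ∀ i, ∃ d, HasDerivAt (fun s => X s i) d t := by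
    intro i
    have := HasDerivAt.fun_sum (u := Finset.univ) fun j _ => ((hM j i).star).mul (hZd j)
    refine ⟨_, this.congr_of_eventuallyEq ?_⟩
    filter_upwards [hX] with s hs
    rw [hs]
    rfl
  choose d hd using hXd
  have h1 : (M t * A - (N * M t - α • M t)) *ᵥ X t + M t *ᵥ d = α • Z t - N *ᵥ Z t := by
    funext i
    have h1 := HasDerivAt.fun_sum (u := Finset.univ) fun j _ => (hM i j).mul (hd j)
    rw [Finset.sum_add_distrib] at h1
    refine (h1.congr_of_eventuallyEq ?_).unique (hZd i)
    filter_upwards [hrel] with s hs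
    rw [hZ]
    exact (congrFun hs i).symm
  have h2 : M t *ᵥ d = M t *ᵥ (-(A *ᵥ X t)) := by
    have hr : M t *ᵥ X t = Z t := hrel.self_of_nhds
    rw [← hr] at h1
    simp only [Matrix.sub_mulVec, Matrix.smul_mulVec, ← Matrix.mulVec_mulVec] at h1
    rw [Matrix.mulVec_neg]
    linear_combination h1
  have h3 : d = -(A *ᵥ X t) := by
    have := congrArg ((M t)ᴴ *ᵥ ·) h2
    simpa only [Matrix.mulVec_mulVec, hu.self_of_nhds, Matrix.one_mulVec] using this
  rw [← h3]
  exact hd i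

section Unique

variable {F : Type*} [NormedAddCommGroup F] [NormedSpace ℝ F] {H : Type*} [TopologicalSpace H]
  {I : ModelWithCorners ℝ F H} {M : Type*} [TopologicalSpace M] [ChartedSpace H M]
  {ι : Type} [Fintype ι]

/-- Values in the sigma type allow fibres over `c 0` and `c T` to be compared without casts; for
calculus a dependent family is more convenient. -/
lemma BundleData.IsParallelAlong.exists_eq {B : BundleData.{u, v} I M ι} {c : ℝ → M}
    {ψ : ℝ → Σ p, B.fiber p} (h : B.IsParallelAlong c ψ) :
    ∃ p : ∀ s, B.fiber (c s), ψ = fun s => ⟨c s, p s⟩ := by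
  have (s : ℝ) : ∃ p : B.fiber (c s), ψ s = ⟨c s, p⟩ := by
    have := h.1 s
    generalize c s = z at this
    subst this
    exact ⟨(ψ s).2, rfl⟩
  choose p hp using this
  exact ⟨p, funext hp⟩

variable [DecidableEq ι] [IsManifold I ∞ M]

/-- Parallel sections along a smooth curve are determined by their value at one point. -/
lemma BundleData.IsParallelAlong.unique {S : Set M} {B : BundleData.{u, v} I M ι}
    (hB : B.IsHermitianBundle S) {c : ℝ → M} (hc : ContMDiff 𝓘(ℝ, ℝ) I ∞ c) (hS : ∀ t, c t ∈ S)
    {ψ φ : ℝ → Σ p, B.fiber p} (hψ : B.IsParallelAlong c ψ) (hφ : B.IsParallelAlong c φ)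
    {t₀ : ℝ} (h₀ : ψ t₀ = φ t₀) : ψ = φ := by
  obtain ⟨p, rfl⟩ := hψ.exists_eq
  obtain ⟨q, rfl⟩ := hφ.exists_eq
  have hdom (l : B.label) : IsOpen (c ⁻¹' B.dom l) := (hB.isOpen_dom l).preimage hc.continuous
  let f (l : B.label) (s : ℝ) : ι → ℂ := fun a => (B.frame l (c s)).repr (p s) a
  let g (l : B.label) (s : ℝ) : ι → ℂ := fun a => (B.frame l (c s)).repr (q s) a
  let A (l : B.label) (s : ℝ) (a b : ι) : ℂ := B.conn l a b (c s) (velocity I c s)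
  have hfg (l : B.label) (s : ℝ) : f l s = g l s ↔ p s = q s := by
    constructor
    · intro h
      exact (B.frame l (c s)).repr.injective (Finsupp.ext fun a => congrFun h a)
    · intro h
      simp only [f, g, h]
  have hf (l : B.label) (s : ℝ) (hs : c s ∈ B.dom l) :
      HasDerivAt (f l) (fun a => -∑ b, A l s a b * f l s b) s :=
    hasDerivAt_pi.2 fun a => hψ.2 l s hs a
  have hg (l : B.label) (s : ℝ) (hs : c s ∈ B.dom l) :
      HasDerivAt (g l) (fun a => -∑ b, A l s a b * g l s b) s :=
    hasDerivAt_pi.2 fun a => hφ.2 l s hs a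
  have hA (l : B.label) (a b : ι) : ContinuousOn (fun s => A l s a b) (c ⁻¹' B.dom l) :=
    ((hB.smooth_conn l a b).contDiffOn_pullback (hdom l) hc.contMDiffOn
      (fun s hs => ⟨hS s, hs⟩) (1 : ℝ)).continuousOn
  -- Uniqueness for the linear equation in one frame; by continuity of the connection matrix its
  -- value at `t` plus one is a Lipschitz constant nearby.
  have hopen : IsOpen {s | p s = q s} := by
    refine isOpen_iff_mem_nhds.2 fun t ht => ?_
    obtain ⟨l, hl⟩ := mem_iUnion.1 (hB.cover (hS t))
    have hb : ∀ᶠ s in 𝓝 t, ∑ a, ∑ b, ‖A l s a b‖ < ∑ a, ∑ b, ‖A l t a b‖ + 1 := by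
      have hcont : ContinuousAt (fun s => ∑ a, ∑ b, ‖A l s a b‖) t :=
        tendsto_finsetSum _ fun a _ => tendsto_finsetSum _ fun b _ =>
          ((hA l a b).continuousAt ((hdom l).mem_nhds hl)).norm
      exact hcont.eventually_lt continuousAt_const (lt_add_one _)
    have hpos : 0 ≤ ∑ a, ∑ b, ‖A l t a b‖ + 1 := by positivity
    have := ODE_solution_unique_of_eventually (K := ⟨_, hpos⟩) (s := fun _ => univ)
      (v := fun s x a => -∑ b, A l s a b * x b) (f := f l) (g := g l) (t₀ := t) ?_ ?_ ?_
      ((hfg l t).2 ht)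
    · filter_upwards [this] with s hs using (hfg l s).1 hs
    · filter_upwards [hb] with s hs
      refine LipschitzWith.lipschitzOnWith (LipschitzWith.of_dist_le_mul fun x y => ?_)
      refine (dist_pi_le_iff (by positivity)).2 fun a => ?_
      rw [dist_neg_neg, dist_eq_norm, ← Finset.sum_sub_distrib]
      calc ‖∑ b, (A l s a b * x b - A l s a b * y b)‖
          ≤ ∑ b, ‖A l s a b‖ * dist x y := by
            refine norm_sum_le_of_le _ fun b _ => ?_
            rw [← mul_sub, norm_mul, ← dist_eq_norm]
            exact mul_le_mul_of_nonneg_left (dist_le_pi_dist x y b) (norm_nonneg _)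
        _ = (∑ b, ‖A l s a b‖) * dist x y := (Finset.sum_mul _ _ _).symm
        _ ≤ (∑ a, ∑ b, ‖A l t a b‖ + 1) * dist x y := by
            refine mul_le_mul_of_nonneg_right (le_trans ?_ hs.le) dist_nonneg
            exact Finset.single_le_sum (f := fun a => ∑ b, ‖A l s a b‖)
              (fun a _ => by positivity) (Finset.mem_univ a)
    · filter_upwards [(hdom l).mem_nhds hl] with s hs using ⟨hf l s hs, mem_univ _⟩
    · filter_upwards [(hdom l).mem_nhds hl] with s hs using ⟨hg l s hs, mem_univ _⟩
  have hclosed : IsClosed {s | p s = q s} := by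
    rw [← isOpen_compl_iff]
    refine isOpen_iff_mem_nhds.2 fun t ht => ?_
    obtain ⟨l, hl⟩ := mem_iUnion.1 (hB.cover (hS t))
    have hne : f l t ≠ g l t := fun h => ht ((hfg l t).1 h)
    filter_upwards [((hf l t hl).continuousAt.sub (hg l t hl).continuousAt).eventually_ne
      (sub_ne_zero.2 hne)] with s hs
    exact fun h => hs (sub_eq_zero.2 ((hfg l s).2 h))
  have huniv : {s | p s = q s} = univ :=
    IsClopen.eq_univ ⟨hclosed, hopen⟩ ⟨t₀, by simpa using h₀⟩
  funext s
  have hs : s ∈ {s | p s = q s} := huniv ▸ mem_univ s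
  exact congrArg (Sigma.mk (c s)) hs

lemma BundleData.IsHolonomy.unique {S : Set M} {B : BundleData.{u, v} I M ι}
    (hB : B.IsHermitianBundle S) {c : ℝ → M} (hc : ContMDiff 𝓘(ℝ, ℝ) I ∞ c) (hS : ∀ t, c t ∈ S)
    {T : ℝ} {h h' : B.fiber (c 0) →ₗ[ℂ] B.fiber (c 0)} (hh : B.IsHolonomy c T h)
    (hh' : B.IsHolonomy c T h') : h = h' := by
  ext x
  obtain ⟨ψ, hψ, hψ0, hψT⟩ := hh x
  obtain ⟨φ, hφ, hφ0, hφT⟩ := hh' x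
  have := hψ.unique hB hc hS hφ (hψ0.trans hφ0.symm)
  rw [this, hφT] at hψT
  simpa using hψT.symm

lemma BundleData.IsHolonomy.hol_eq {S : Set M} {B : BundleData.{u, v} I M ι}
    (hB : B.IsHermitianBundle S) {c : ℝ → M} (hc : ContMDiff 𝓘(ℝ, ℝ) I ∞ c) (hS : ∀ t, c t ∈ S)
    {T : ℝ} {h : B.fiber (c 0) →ₗ[ℂ] B.fiber (c 0)} (hh : B.IsHolonomy c T h) :
    B.hol c T = h := by
  have hex : ∃ h, B.IsHolonomy c T h := ⟨h, hh⟩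
  unfold BundleData.hol
  rw [dif_pos hex]
  exact hex.choose_spec.unique hB hc hS hh

end Unique

variable {EQ : Type*} [NormedAddCommGroup EQ] [NormedSpace ℝ EQ]
  {EY : Type*} [NormedAddCommGroup EY] [NormedSpace ℝ EY]
  {Q : Type*} [TopologicalSpace Q] [ChartedSpace EQ Q]
  {Y : Type*} [TopologicalSpace Y] [ChartedSpace EY Y] [IsManifold 𝓘(ℝ, EY) ∞ Y]
  {π : Y → Q} {G : BundleGerbe.{u, v} EY π} {r : ℕ} {E : GerbeModule.{u, v, u₁, v₁} G r}
  {σ : DiskMap EQ Q} {J J' : Trivialisation.{u, v, u₂, v₂} G σ}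
  {EJ : Descent.{u, v, u₁, v₁, u₂, v₂, u₃, v₃} E J}
  {EJ' : Descent.{u, v, u₁, v₁, u₂, v₂, u₃, v₃} E J'}

/-- After evaluation in `E`, both sides are governed by the same connection form `N`. The factor `w
* g` compensates the difference of the scalar forms of `J` and `J'`, so no regularity of `ρ` is
required. -/
lemma Comparison.isParallelAlong (C : Comparison EJ EJ') {x : ℝ → ℂ} (hx : ContDiff ℝ ∞ x)
    {w : ℝ → ℂ} (hw : ∀ t, C.HasLogDeriv x w 0 t)
    (hlift : ∀ t, ∃ l l' y, IsLiftAt J J' l l' x y t)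
    {ψ : ℝ → Σ p, EJ'.bundle.fiber p} (hψ : EJ'.bundle.IsParallelAlong x ψ) :
    EJ.bundle.IsParallelAlong x (fun s => ⟨(ψ s).1, w s • C.ρ (ψ s).1 (ψ s).2⟩) := by
  obtain ⟨p, rfl⟩ := hψ.exists_eq
  refine ⟨fun t => rfl, fun b t hb => ?_⟩
  obtain ⟨l, l', y, hy⟩ := hlift t
  have hk := hw t l l' y hy
  obtain ⟨W, hW, ht, hc, hS⟩ := hy
  obtain ⟨b', hb'⟩ := mem_iUnion.1 (EJ'.isHermitianBundle.cover (hS t ht).1.1.choose)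
  obtain ⟨e, he⟩ := mem_iUnion.1 (E.isHermitianBundle.cover (mem_univ (y t)))
  have hyW : ContMDiffOn 𝓘(ℝ, ℝ) 𝓘(ℝ, EY) ∞ y W := contMDiff_snd.comp_contMDiffOn hc
  have hV : IsOpen ((W ∩ y ⁻¹' E.bundle.dom e) ∩ (x ⁻¹' (EJ.bundle.dom b ∩ EJ'.bundle.dom b'))) :=
    (hyW.continuousOn.isOpen_inter_preimage hW (E.isHermitianBundle.isOpen_dom e)).inter
      (((EJ.isHermitianBundle.isOpen_dom b).inter
        (EJ'.isHermitianBundle.isOpen_dom b')).preimage hx.continuous)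
  set V := (W ∩ y ⁻¹' E.bundle.dom e) ∩ (x ⁻¹' (EJ.bundle.dom b ∩ EJ'.bundle.dom b'))
  have htV : t ∈ V := ⟨⟨ht, he⟩, hb, hb'⟩
  have hcV := hc.mono (fun s hs => hs.1.1 : V ⊆ W)
  have hd := EJ.hasDerivAt_evalMatrix b e l hV hcV (fun s hs => ⟨(hS s hs.1.1).1.1, hs.2.1,
    hs.1.2, (hS s hs.1.1).1.2⟩) htV
  have hd' := EJ'.hasDerivAt_evalMatrix b' e l' hV hcV (fun s hs => ⟨(hS s hs.1.1).1.1, hs.2.2,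
    hs.1.2, (hS s hs.1.1).2⟩) htV
  refine hasDerivAt_of_gauge (M := fun s => EJ.evalMatrix b e l (x s, y s))
    (M' := fun s => EJ'.evalMatrix b' e l' (x s, y s))
    (X := fun s a => (EJ.bundle.frame b (x s)).repr (w s • C.ρ (x s) (p s)) a)
    (X' := fun s a => (EJ'.bundle.frame b' (x s)).repr (p s) a)
    (k := fun s => w s * C.g l l' (x s, y s))
    (A := fun i j => EJ.bundle.conn b i j (x t) (velocity 𝓘(ℝ, ℂ) x t))
    (A' := fun i j => EJ'.bundle.conn b' i j (x t) (velocity 𝓘(ℝ, ℂ) x t))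
    (N := fun i j => E.bundle.conn e i j (y t) (velocity 𝓘(ℝ, EY) y t))
    (α := J.line.conn l () () (x t, y t) (velocity (diskModel EY) (fun s => (x s, y s)) t))
    (α' := J'.line.conn l' () () (x t, y t) (velocity (diskModel EY) (fun s => (x s, y s)) t))
    hd hd' (fun i => hψ.2 b' t hb' i) hk ?_ ?_
  · filter_upwards [hV.mem_nhds htV] with s hs
    exact EJ.evalMatrix_unitary (hS s hs.1.1).1.1 hs.2.1 hs.1.2 (hS s hs.1.1).1.2
  · filter_upwards [hV.mem_nhds htV] with s hs
    have h1 := LinearMap.toMatrix_mulVec_repr (EJ.bundle.frame b (x s)) (E.bundle.frame e (y s))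
      (EJ.eval l (x s, y s)) (w s • C.ρ (x s) (p s))
    have h2 := LinearMap.toMatrix_mulVec_repr (EJ'.bundle.frame b' (x s)) (E.bundle.frame e (y s))
      (EJ'.eval l' (x s, y s)) (p s)
    refine h1.trans ?_
    refine Eq.trans ?_ (congrArg (fun X => (w s * C.g l l' (x s, y s)) • X) h2.symm)
    have h3 := C.eval_ρ l l' _ (hS s hs.1.1) (p s)
    dsimp only at h3
    rw [map_smul, h3, smul_smul, map_smul]
    rfl

lemma Comparison.isHolonomy (C : Comparison EJ EJ') {x : ℝ → ℂ} (hx : ContDiff ℝ ∞ x)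
    {w : ℝ → ℂ} (hw : ∀ t, C.HasLogDeriv x w 0 t) (hw₀ : ∀ t, w t ≠ 0)
    (hlift : ∀ t, ∃ l l' y, IsLiftAt J J' l l' x y t) {T : ℝ} {k : ℂ} (hT : w T = k * w 0)
    (e : EJ'.bundle.fiber (x 0) ≃ₗ[ℂ] EJ.bundle.fiber (x 0)) (he : ∀ a, e a = C.ρ (x 0) a)
    {h : EJ'.bundle.fiber (x 0) →ₗ[ℂ] EJ'.bundle.fiber (x 0)}
    (hh : EJ'.bundle.IsHolonomy x T h) : EJ.bundle.IsHolonomy x T (k • e.conj h) := by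
  intro a
  -- The initial vector is chosen so that its image under `w 0 • ρ` is `a`.
  obtain ⟨ψ, hψ, hψ0, hψT⟩ := hh (e.symm ((w 0)⁻¹ • a))
  refine ⟨_, C.isParallelAlong hx hw hlift hψ, ?_, ?_⟩
  · rw [hψ0, ← he, e.apply_symm_apply, smul_smul, mul_inv_cancel₀ (hw₀ 0), one_smul]
  · rw [hψT, ← he, hT, LinearMap.smul_apply, LinearEquiv.conj_apply_apply, map_smul, map_smul,
      map_smul,
      smul_smul, mul_assoc, mul_inv_cancel₀ (hw₀ 0), mul_one]

end Transport

/-! ### Integrals over the disk in polar coordinates -/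

section Integral

open MeasureTheory

lemma mfderiv_polarDisk_fst (z : ℝ × ℝ) :
    mfderiv 𝓘(ℝ, ℝ × ℝ) 𝓘(ℝ, ℂ) polarDisk z ((1, 0) : ℝ × ℝ) =
      (Real.cos z.1 • boundaryCircle z.2 : ℂ) := by
  have hd : DifferentiableAt ℝ polarDisk z := contDiff_polarDisk.differentiable (by simp) z
  rw [mfderiv_eq_fderiv]
  have h1 : HasDerivAt (fun s : ℝ => (s, z.2)) ((1, 0) : ℝ × ℝ) z.1 :=
    (hasDerivAt_id _).prodMk (hasDerivAt_const _ _)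
  have h2 := HasFDerivAt.comp_hasDerivAt (f := fun s : ℝ => (s, z.2)) z.1 hd.hasFDerivAt h1
  exact h2.unique ((Real.hasDerivAt_sin z.1).smul_const (boundaryCircle z.2))

lemma hasDerivAt_boundaryCircle (t : ℝ) :
    HasDerivAt boundaryCircle (Complex.I * boundaryCircle t) t := by
  have h := ((Complex.ofRealCLM.hasDerivAt (x := t)).mul_const Complex.I).cexp
  refine h.congr_deriv ?_
  simp [boundaryCircle, mul_comm]

lemma mfderiv_polarDisk_snd (z : ℝ × ℝ) :
    mfderiv 𝓘(ℝ, ℝ × ℝ) 𝓘(ℝ, ℂ) polarDisk z ((0, 1) : ℝ × ℝ) =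
      (Real.sin z.1 • (Complex.I * boundaryCircle z.2) : ℂ) := by
  have hd : DifferentiableAt ℝ polarDisk z := contDiff_polarDisk.differentiable (by simp) z
  rw [mfderiv_eq_fderiv]
  have h1 : HasDerivAt (fun t : ℝ => (z.1, t)) ((0, 1) : ℝ × ℝ) z.2 :=
    (hasDerivAt_const _ _).prodMk (hasDerivAt_id _)
  have h2 := HasFDerivAt.comp_hasDerivAt (f := fun t : ℝ => (z.1, t)) z.2 hd.hasFDerivAt h1
  exact h2.unique ((hasDerivAt_boundaryCircle z.2).const_smul (Real.sin z.1))

lemma pullbackDiff_polarDisk {μ μ' : TwoTensor 𝓘(ℝ, ℂ) ℂ} (hμ : IsSmoothTwoForm 𝓘(ℝ, ℂ) disk μ)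
    (hμ' : IsSmoothTwoForm 𝓘(ℝ, ℂ) disk μ') (z : ℝ × ℝ) :
    pullbackDiff polarDisk μ μ' z = (Real.cos z.1 * Real.sin z.1) •
      (μ (polarDisk z) (1 : ℂ) Complex.I - μ' (polarDisk z) (1 : ℂ) Complex.I) := by
  unfold pullbackDiff
  rw [mfderiv_polarDisk_fst, mfderiv_polarDisk_snd, smul_sub]
  exact congrArg₂ _
    (alternating_polar (μ (polarDisk z)) (hμ.1 _ (polarDisk_mem z)) _ (norm_boundaryCircle _) _ _)
    (alternating_polar (μ' (polarDisk z)) (hμ'.1 _ (polarDisk_mem z)) _ (norm_boundaryCircle _) _ _)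

/-- Integration over the disk in the coordinates `(sin s, t)`. -/
lemma integral_disk_eq {f : ℂ → ℂ} (hf : ContinuousOn f disk) :
    ∫ z in disk, f z = ∫ t in (0 : ℝ)..(2 * Real.pi), ∫ s in (0 : ℝ)..(Real.pi / 2),
      (Real.cos s * Real.sin s) • f (polarDisk (s, t)) := by
  have hms : MeasurableSet disk := Metric.isClosed_closedBall.measurableSet
  have hpol (p : ℝ × ℝ) : Complex.polarCoord.symm p = p.1 • boundaryCircle p.2 := by
    rw [Complex.polarCoord_symm_apply, boundaryCircle, Complex.exp_mul_I, Complex.real_smul]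
    push_cast
    ring
  have hmem (ρ t : ℝ) (hρ : ρ ∈ Icc (0 : ℝ) 1) : ρ • boundaryCircle t ∈ disk := by
    unfold disk
    rw [mem_closedBall_zero_iff, norm_smul, norm_boundaryCircle, mul_one, Real.norm_eq_abs,
      abs_of_nonneg hρ.1]
    exact hρ.2
  let F (p : ℝ × ℝ) : ℂ := p.1 • f (p.1 • boundaryCircle p.2)
  have hcb : Continuous boundaryCircle := contDiff_boundaryCircle.continuous
  have hF : ContinuousOn F (Icc (0 : ℝ) 1 ×ˢ univ) :=
    continuousOn_fst.smul (hf.comp (by fun_prop) fun p hp => hmem _ _ hp.1)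
  -- Substitution of the radius by `sin s`: `sin s` is the polar Jacobian and `cos s` comes from the
  -- change of variable.
  have hsub (t : ℝ) : ∫ s in (0 : ℝ)..(Real.pi / 2),
      (Real.cos s * Real.sin s) • f (polarDisk (s, t)) = ∫ ρ in (0 : ℝ)..1, F (ρ, t) := by
    have himg : Real.sin '' uIcc 0 (Real.pi / 2) ⊆ Icc 0 1 := by
      rintro _ ⟨s, hs, rfl⟩
      rw [uIcc_of_le (by positivity)] at hs
      exact ⟨Real.sin_nonneg_of_nonneg_of_le_pi hs.1 (by linarith [hs.2, Real.pi_pos]),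
        Real.sin_le_one s⟩
    have hFt : ContinuousOn (fun ρ => F (ρ, t)) (Icc 0 1) :=
      hF.comp (by fun_prop) fun ρ hρ => ⟨hρ, mem_univ _⟩
    have := intervalIntegral.integral_deriv_smul_comp' (a := 0) (b := Real.pi / 2)
      (f := Real.sin) (f' := Real.cos) (g := fun ρ => F (ρ, t))
      (fun s _ => Real.hasDerivAt_sin s) Real.continuous_cos.continuousOn (hFt.mono himg)
    rw [Real.sin_zero, Real.sin_pi_div_two] at this
    rw [← this]
    refine intervalIntegral.integral_congr fun s _ => ?_
    simp only [Function.comp, F, smul_smul, polarDisk]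
  simp_rw [hsub]
  rw [← integral_indicator hms, ← Complex.integral_comp_polarCoord_symm]
  have hind : ∀ p ∈ polarCoord.target, p.1 • disk.indicator f (Complex.polarCoord.symm p) =
      (Ioc (0 : ℝ) 1 ×ˢ Ioo (-Real.pi) Real.pi).indicator F p := by
    intro p hp
    rw [polarCoord_target] at hp
    rw [hpol]
    by_cases h1 : p.1 ≤ 1
    · have hp' : p ∈ Ioc (0 : ℝ) 1 ×ˢ Ioo (-Real.pi) Real.pi := ⟨⟨hp.1, h1⟩, hp.2⟩
      rw [indicator_of_mem (hmem _ _ ⟨le_of_lt hp.1, h1⟩), indicator_of_mem hp']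
    · rw [indicator_of_notMem, indicator_of_notMem, smul_zero]
      · exact fun h => h1 h.1.2
      · unfold disk
        rw [mem_closedBall_zero_iff, norm_smul, norm_boundaryCircle, mul_one, Real.norm_eq_abs,
          abs_of_pos hp.1]
        exact h1
  have hmt : MeasurableSet (Ioc (0 : ℝ) 1 ×ˢ Ioo (-Real.pi) Real.pi) :=
    measurableSet_Ioc.prod measurableSet_Ioo
  have hinter : polarCoord.target ∩ (Ioc (0 : ℝ) 1 ×ˢ Ioo (-Real.pi) Real.pi) =
      Ioc (0 : ℝ) 1 ×ˢ Ioo (-Real.pi) Real.pi := by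
    rw [polarCoord_target]
    exact inter_eq_right.2 (prod_mono Ioc_subset_Ioi_self le_rfl)
  rw [setIntegral_congr_fun polarCoord.open_target.measurableSet hind,
    setIntegral_indicator hmt, hinter, Measure.volume_eq_prod]
  have hint : IntegrableOn F (Ioc (0 : ℝ) 1 ×ˢ Ioo (-Real.pi) Real.pi) (volume.prod volume) := by
    have hK : IsCompact (Icc (0 : ℝ) 1 ×ˢ Icc (-Real.pi) Real.pi) :=
      isCompact_Icc.prod isCompact_Icc
    have : IntegrableOn F (Icc (0 : ℝ) 1 ×ˢ Icc (-Real.pi) Real.pi) (volume.prod volume) :=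
      (hF.mono (prod_mono le_rfl (subset_univ _))).integrableOn_compact hK
    exact this.mono_set (prod_mono Ioc_subset_Icc_self Ioo_subset_Icc_self)
  rw [IntegrableOn, ← Measure.prod_restrict] at hint
  rw [← Measure.prod_restrict, integral_prod_symm F hint, ← integral_Ioc_eq_integral_Ioo,
    ← intervalIntegral.integral_of_le (by linarith [Real.pi_pos])]
  simp_rw [← intervalIntegral.integral_of_le (zero_le_one (α := ℝ))]
  -- The polar chart has angles in `(-π, π)`; periodicity moves this window to `[0, 2π]`.
  have hper : Function.Periodic (fun t => ∫ ρ in (0 : ℝ)..1, F (ρ, t)) (2 * Real.pi) := by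
    intro t
    have : boundaryCircle (t + 2 * Real.pi) = boundaryCircle t := by
      unfold boundaryCircle
      push_cast
      rw [add_mul, Complex.exp_add, Complex.exp_two_pi_mul_I, mul_one]
    simp only [F, this]
  have := hper.intervalIntegral_add_eq (-Real.pi) 0
  rwa [zero_add, show -Real.pi + 2 * Real.pi = Real.pi by ring] at this

end Integral

/-! ### Independence of the trivialisation -/

section Independence

universe u v u₁ v₁ u₂ v₂ u₃ v₃

lemma integral_pullbackDiff {μ μ' : TwoTensor 𝓘(ℝ, ℂ) ℂ} (hμ : IsSmoothTwoForm 𝓘(ℝ, ℂ) disk μ)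
    (hμ' : IsSmoothTwoForm 𝓘(ℝ, ℂ) disk μ') :
    ∫ t in (0 : ℝ)..(2 * Real.pi), ∫ s in (0 : ℝ)..(Real.pi / 2),
      pullbackDiff polarDisk μ μ' (s, t) =
    (∫ z in disk, μ z (1 : ℂ) (Complex.I : ℂ)) - ∫ z in disk, μ' z (1 : ℂ) (Complex.I : ℂ) := by
  have hK : IsCompact disk := isCompact_closedBall 0 1
  have h1 := hμ.continuousOn_apply 1 Complex.I
  have h2 := hμ'.continuousOn_apply 1 Complex.I
  rw [← MeasureTheory.integral_sub (h1.integrableOn_compact hK) (h2.integrableOn_compact hK)]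
  refine Eq.trans ?_ (integral_disk_eq (h1.sub h2)).symm
  simp_rw [pullbackDiff_polarDisk hμ hμ']
  rfl

variable {EQ : Type*} [NormedAddCommGroup EQ] [NormedSpace ℝ EQ]
  {EY : Type*} [NormedAddCommGroup EY] [NormedSpace ℝ EY]
  {Q : Type*} [TopologicalSpace Q] [ChartedSpace EQ Q] [IsManifold 𝓘(ℝ, EQ) ∞ Q]
  {Y : Type*} [TopologicalSpace Y] [ChartedSpace EY Y] [IsManifold 𝓘(ℝ, EY) ∞ Y]
  {π : Y → Q} {G : BundleGerbe.{u, v} EY π} {r : ℕ} {E : GerbeModule.{u, v, u₁, v₁} G r}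
  {σ : DiskMap EQ Q}

lemma exists_isHolonomy_transfer (hπ : Manifold.IsSubmersion 𝓘(ℝ, EY) 𝓘(ℝ, EQ) ∞ π)
    (hs : Function.Surjective π) (hr : 0 < r) {J J' : Trivialisation.{u, v, u₂, v₂} G σ}
    (EJ : Descent.{u, v, u₁, v₁, u₂, v₂, u₃, v₃} E J)
    (EJ' : Descent.{u, v, u₁, v₁, u₂, v₂, u₃, v₃} E J')
    {μ μ' : TwoTensor 𝓘(ℝ, ℂ) ℂ} (hμ : J.IsCurvingDefect μ) (hμ' : J'.IsCurvingDefect μ') :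
    ∃ e : EJ'.bundle.fiber (boundaryCircle 0) ≃ₗ[ℂ] EJ.bundle.fiber (boundaryCircle 0),
      ∀ h, EJ'.bundle.IsHolonomy boundaryCircle (2 * Real.pi) h →
        EJ.bundle.IsHolonomy boundaryCircle (2 * Real.pi)
          (Complex.exp (-((∫ z in disk, μ z (1 : ℂ) (Complex.I : ℂ)) -
            ∫ z in disk, μ' z (1 : ℂ) (Complex.I : ℂ))) • e.conj h) := by
  obtain ⟨C⟩ := exists_comparison EJ EJ' hs
  obtain ⟨w, hw₀, hw, hT⟩ := C.exists_parallel hπ hs hr hμ hμ'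
  rw [integral_pullbackDiff hμ.1 hμ'.1] at hT
  exact ⟨LinearEquiv.ofBijective _ (C.bijective _ (boundaryCircle_mem 0)), fun h hh =>
    C.isHolonomy contDiff_boundaryCircle hw hw₀ (isLiftAt_of_exists_lift hπ hs J J'
      contDiff_boundaryCircle boundaryCircle_mem) hT _ (fun _ => rfl) hh⟩

lemma sValue_eq_sValue (hπ : Manifold.IsSubmersion 𝓘(ℝ, EY) 𝓘(ℝ, EQ) ∞ π)
    (hs : Function.Surjective π) {J J' : Trivialisation.{u, v, u₂, v₂} G σ}
    (EJ : Descent.{u, v, u₁, v₁, u₂, v₂, u₃, v₃} E J)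
    (EJ' : Descent.{u, v, u₁, v₁, u₂, v₂, u₃, v₃} E J')
    {μ μ' : TwoTensor 𝓘(ℝ, ℂ) ℂ} (hμ : J.IsCurvingDefect μ) (hμ' : J'.IsCurvingDefect μ') :
    sValue EJ.bundle μ = sValue EJ'.bundle μ' := by
  unfold sValue
  -- In rank zero the coefficients `g` are not determined by the fibres, but all traces vanish.
  rcases Nat.eq_zero_or_pos r with rfl | hr
  · have htr (B : BundleData.{u₃, v₃} 𝓘(ℝ, ℂ) ℂ (Fin 0)) (hB : B.IsHermitianBundle disk)
        (f : B.fiber (boundaryCircle 0) →ₗ[ℂ] B.fiber (boundaryCircle 0)) :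
        LinearMap.trace ℂ _ f = 0 := by
      obtain ⟨l, -⟩ := mem_iUnion.1 (hB.cover (boundaryCircle_mem 0))
      rw [LinearMap.trace_eq_matrix_trace ℂ (B.frame l (boundaryCircle 0))]
      exact Matrix.trace_fin_zero _
    rw [htr _ EJ.isHermitianBundle, htr _ EJ'.isHermitianBundle, zero_mul, zero_mul]
  have hsm : ContMDiff 𝓘(ℝ, ℝ) 𝓘(ℝ, ℂ) ∞ boundaryCircle := contDiff_boundaryCircle.contMDiff
  obtain ⟨e, he⟩ := exists_isHolonomy_transfer hπ hs hr EJ EJ' hμ hμ'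
  obtain ⟨e', he'⟩ := exists_isHolonomy_transfer hπ hs hr EJ' EJ hμ' hμ
  by_cases hex : ∃ h, EJ'.bundle.IsHolonomy boundaryCircle (2 * Real.pi) h
  · obtain ⟨h, hh⟩ := hex
    rw [hh.hol_eq EJ'.isHermitianBundle hsm boundaryCircle_mem,
      (he h hh).hol_eq EJ.isHermitianBundle hsm boundaryCircle_mem, map_smul,
      LinearMap.trace_conj', smul_eq_mul, mul_right_comm, ← Complex.exp_add, mul_comm]
    congr 2
    ring
  -- The transfer in the opposite direction excludes that only one holonomy exists; with neither,
  -- both `hol` take the default value `0`.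
  · have hex' : ¬ ∃ h, EJ.bundle.IsHolonomy boundaryCircle (2 * Real.pi) h :=
      fun ⟨h, hh⟩ => hex ⟨_, he' h hh⟩
    unfold BundleData.hol
    rw [dif_neg hex, dif_neg hex', map_zero, map_zero, zero_mul, zero_mul]

end Independence

end

end BundleGerbes

theorem mainTheorem2
    {EQ : Type*} [NormedAddCommGroup EQ] [NormedSpace ℝ EQ]
    {EY : Type*} [NormedAddCommGroup EY] [NormedSpace ℝ EY]
    {Q : Type*} [TopologicalSpace Q] [ChartedSpace EQ Q] [IsManifold 𝓘(ℝ, EQ) ∞ Q]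
    {Y : Type*} [TopologicalSpace Y] [ChartedSpace EY Y] [IsManifold 𝓘(ℝ, EY) ∞ Y]
    (π : Y → Q) (hπ : Manifold.IsSubmersion 𝓘(ℝ, EY) 𝓘(ℝ, EQ) ∞ π) (hπ_surj : Function.Surjective π)
    (G : BundleGerbe EY π) (r : ℕ) (E : GerbeModule G r) :
    ∃ s : DiskMap EQ Q → ℂ, ∀ (σ : DiskMap EQ Q) (J : Trivialisation G σ)
      (μ : TwoTensor 𝓘(ℝ, ℂ) ℂ) (_ : J.IsCurvingDefect μ) (EJ : Descent E J),
      sValue EJ.bundle μ = s σ := by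
  have h (σ : DiskMap EQ Q) : ∃ c : ℂ, ∀ (J : Trivialisation G σ)
      (μ : TwoTensor 𝓘(ℝ, ℂ) ℂ) (_ : J.IsCurvingDefect μ) (EJ : Descent E J),
      sValue EJ.bundle μ = c := by
    -- Any one choice of data supplies the value; without data the condition is vacuous and `0`
    -- serves.
    by_cases hex : ∃ (J : Trivialisation G σ) (μ : TwoTensor 𝓘(ℝ, ℂ) ℂ) (_ : Descent E J),
      J.IsCurvingDefect μ
    · obtain ⟨J', μ', EJ', hμ'⟩ := hex
      exact ⟨sValue EJ'.bundle μ', fun J μ hμ EJ =>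
        sValue_eq_sValue hπ hπ_surj EJ EJ' hμ hμ'⟩
    · exact ⟨0, fun J μ hμ EJ => absurd ⟨J, μ, EJ, hμ⟩ hex⟩
  choose s hs using h
  exact ⟨s, hs⟩
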